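/- A signed graph $\Sigma=(G,\sigma)$ is a finite simple graph $G$ together with a map $\sigma:E(G)\to\{+1,-1\}$. Its adjacency matrix $A=A(\Sigma)$ has the entry $\sigma(ij)$ at $(i,j)$ if $i$ and $j$ are adjacent, and $0$ otherwise. Write $\chi(\Sigma;x)=\det(xI-A)$, and let $\Delta_\Sigma$ be the discriminant of $\chi(\Sigma;x)$. Two signed graphs $\Sigma_1,\Sigma_2$ are generalized cospectral if $\det(xI-A(\Sigma_1))=\det(xI-A(\Sigma_2))$ and $\det(xI-(J-I-A(\Sigma_1)))=\det(xI-(J-I-A(\Sigma_2)))$, where $J$ is the all-ones matrix. $\Sigma$ is determined by its generalized spectrum if every signed graph that is generalized cospectral with $\Sigma$ is isomorphic to $\Sigma$ (by a graph isomorphism that preserves the signs of the edges). **Theorem.** Let $\Sigma$ be a signed bipartite graph with $n$ vertices, and let $W=[e,Ae,\ldots,A^{n-1}e]$ be its walk matrix, where $e$ is the all-ones vector. Assume that $\Sigma$ is controllable ($\operatorname{rank}W=n$) or almost controllable ($\operatorname{rank}W=n-1$), and that the constant coefficient (if $n$ is even) or the linear coefficient (if $n$ is odd) of $\chi(\Sigma;x)$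 is $\pm1$. Then: 1. For every bipartition of the vertex set into classes $X$ and $Y$ (every edge joins $X$ to $Y$) with $|X|\le\lfloor n/2\rfloor$, the block $B$ of $A$ with rows indexed by $X$ and columns indexed by $Y$ satisfies $2^{-\lfloor n/2\rfloor}\sqrt{\Delta_\Sigma}=\Delta_{BB^{\mathsf T}}$, where $\Delta_{BB^{\mathsf T}}$ is the discriminant of the characteristic polynomial of $BB^{\mathsf T}$. In particular $2^{-\lfloor n/2\rfloor}\sqrt{\Delta_\Sigma}$ is an integer. 2. If the integer $2^{-\lfloor n/2\rfloor}\sqrt{\Delta_\Sigma}$ is squarefree, then it is odd and $\Sigma$ is determined by its generalized spectrum. -/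

import Mathlib

open Polynomial

universe u v

/-- A signed graph on the vertex set `V`: a simple graph with a map from its edge set to `{1, -1}`. -/
structure SignedGraph (V : Type u) where
  graph : SimpleGraph V
  sign : graph.edgeSet → ℤˣ

namespace SignedGraph

/-- Isomorphism of signed graphs: a graph isomorphism that preserves the sign of every edge. -/
def IsIsomorphic {V : Type u} {W : Type v} (S : SignedGraph V) (T : SignedGraph W) : Prop :=
  ∃ f : S.graph ≃g T.graph, ∀ e : S.graph.edgeSet, T.sign (f.mapEdgeSet e) = S.sign e

open Classical in
/-- The adjacency matrix: the sign of the edge `ij` if `i` and `j` are adjacent, else `0`. -/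
noncomputable def adjMatrix {V : Type u} (S : SignedGraph V) : Matrix V V ℤ :=
  Matrix.of fun i j =>
    if h : S.graph.Adj i j then ((S.sign ⟨s(i, j), S.graph.mem_edgeSet.mpr h⟩ : ℤˣ) : ℤ) else 0

section Finite

variable {V : Type u} [Fintype V] [DecidableEq V]

/-- The characteristic polynomial `det (xI - A)`. -/
noncomputable def charpoly (S : SignedGraph V) : ℤ[X] :=
  S.adjMatrix.charpoly

/-- The characteristic polynomial `det (xI - (J - I - A))` of the formal complement. -/
noncomputable def complCharpoly (S : SignedGraph V) : ℤ[X] :=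
  ((Matrix.of fun _ _ => 1) - 1 - S.adjMatrix : Matrix V V ℤ).charpoly

/-- The discriminant of the characteristic polynomial. -/
noncomputable def discr (S : SignedGraph V) : ℤ :=
  S.charpoly.discr

/-- The walk matrix `[e, Ae, …, A ^ (n - 1) e]`, with `e` the all-ones vector. -/
noncomputable def walkMatrix (S : SignedGraph V) : Matrix V (Fin (Fintype.card V)) ℤ :=
  Matrix.of fun i k => (S.adjMatrix ^ (k : ℕ)).mulVec (fun _ => 1) i

/-- The rank of the walk matrix, as a matrix over `ℚ`. -/
noncomputable def walkRank (S : SignedGraph V) : ℕ :=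
  (S.walkMatrix.map (Int.cast : ℤ → ℚ)).rank

/-- The walk matrix has rank `n`. -/
def IsControllable (S : SignedGraph V) : Prop :=
  S.walkRank = Fintype.card V

/-- The walk matrix has rank `n - 1`. -/
def IsAlmostControllable (S : SignedGraph V) : Prop :=
  S.walkRank + 1 = Fintype.card V

/-- The block `B` of the adjacency matrix with rows in `X` and columns outside `X`. -/
noncomputable def block (S : SignedGraph V) (X : Finset V) :
    Matrix {v // v ∈ X} {v // v ∉ X} ℤ :=
  S.adjMatrix.submatrix Subtype.val Subtype.val

/-- Two signed graphs are generalized cospectral if they have the same characteristic polynomial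
and so have their formal complements. -/
def GeneralizedCospectral {W : Type v} [Fintype W] [DecidableEq W]
    (S : SignedGraph V) (T : SignedGraph W) : Prop :=
  S.charpoly = T.charpoly ∧ S.complCharpoly = T.complCharpoly

end Finite

/-- `S` is determined by its generalized spectrum: every (finite) signed graph that is generalized
cospectral with `S` is isomorphic to `S`. -/
def IsDGS {V : Type u} [Fintype V] [DecidableEq V] (S : SignedGraph V) : Prop :=
  ∀ (W : Type v) [Fintype W] [DecidableEq W] (T : SignedGraph W),
    S.GeneralizedCospectral T → S.IsIsomorphic T

end SignedGraph

/-! Write `A` in blocks `[[0, B], [Bᵀ, 0]]`, let `M = BBᵀ` with characteristic polynomial `p`, and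
let `m = ⌊n/2⌋`. The coefficient condition forces `χ = p(x²)` or `χ = x p(x²)`, with `p(0) = ±1`.
The nonzero roots of `χ` are the pairs `±√z`, and evaluating `χ'` there gives `Δ_Σ = 4^m Δ_p²`,
because the roots of `p` multiply to `±1`.

A generalized cospectral mate `A'` has the same walk counts `eᵀAᵏe`, so the two walk matrices have
the same Gram matrix. Corank at most one then yields a rational orthogonal `Q` with `Qe = e` and `QA
= A'Q` (`exists_orthogonal_mul_eq`, `mul_eq_mul_of_orthogonal`). If `Q` is integral it is a
permutation matrix, so integrality is the whole point.

A row `r` of `Q` has integral moments `r Aᵏ rᵀ = (A'ᵏ)ᵢᵢ`. Clear denominators to get an integer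
vector `x`; if a prime `q` divides the denominator, then `q²` divides every `xᵀAᵏx`. Since `χ`
divides the 2×2 minors of `adj(tI - A)`, the square of `xᵀ adj(tI - A) eᵢ` lies in `(χ, q²)`. If
this puts the polynomial itself in `(χ, q)`, which is `SqDetects`, then `q` divides `x` and the
denominator shrinks.

Squarefreeness supplies `SqDetects`. If `q² ∣ f²` but `q ∤ f` in `ℤ[x]/p`, then `f` is a null vector
modulo `q` of the trace form with norm divisible by `q²`, so `q² ∣ Δ_p`. Passing to `p(x²)` adjoins
a square root of the unit `x`; for `q = 2` this also needs `ℤ[x]/p` reduced modulo 2, which holds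
because `Δ_p` even would imply `4 ∣ Δ_p`. The same implication makes `Δ_p` odd. The extra factor `x`
is harmless because `p(0) = ±1`. -/

/-! ### Discriminants of monic polynomials. -/

namespace Polynomial

lemma discr_one_eq {R : Type*} [CommRing R] : (1 : R[X]).discr = 1 := by
  rw [← C_1, discr_C]

/-- The resultant with formal degrees `n` and `n - 1` commutes with ring maps even when the degree
of the derivative drops. -/
lemma Monic.discr_map {R S : Type*} [CommRing R] [CommRing S] [Nontrivial S] {f : R[X]}
    (hf : f.Monic) (φ : R →+* S) : (f.map φ).discr = φ f.discr := by
  have hR : Nontrivial R := φ.domain_nontrivial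
  rcases Nat.eq_zero_or_pos f.natDegree with h0 | hpos
  · rw [hf.natDegree_eq_zero.mp h0]
    simp [discr_one_eq]
  have hdeg : (f.map φ).natDegree = f.natDegree := hf.natDegree_map φ
  have h1 := resultant_deriv (natDegree_pos_iff_degree_pos.mp hpos)
  have h2 := resultant_deriv (f := f.map φ) (natDegree_pos_iff_degree_pos.mp (hdeg ▸ hpos))
  rw [derivative_map, resultant_map_map, hdeg, h1, hf.leadingCoeff, (hf.map φ).leadingCoeff] at h2
  simp only [map_mul, map_pow, map_neg, map_one, mul_one] at h2
  exact ((isUnit_one.neg.pow _).mul_left_cancel h2).symm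

lemma eval_derivative_prod_X_sub_C {ι K : Type*} [Fintype ι] [DecidableEq ι] [CommRing K]
    (r : ι → K) (k : ι) :
    (derivative (∏ i, (X - C (r i)))).eval (r k) = ∏ j ∈ {k}ᶜ, (r k - r j) := by
  rw [derivative_prod_finset, eval_finsetSum, Finset.sum_eq_single k]
  · simp [eval_prod, Finset.compl_singleton]
  · intro b _ hb
    simp only [eval_mul, eval_prod]
    rw [Finset.prod_eq_zero (i := k) (by simp [hb.symm]) (by simp), zero_mul]
  · simp

lemma resultant_derivative_prod_X_sub_C {ι K : Type*} [Fintype ι] [DecidableEq ι] [Field K]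
    (r : ι → K) :
    resultant (∏ i, (X - C (r i))) (derivative (∏ i, (X - C (r i)))) (Fintype.card ι)
      (Fintype.card ι - 1) = ∏ i, ∏ j ∈ {i}ᶜ, (r i - r j) := by
  have hdeg : (∏ i, (X - C (r i))).natDegree = Fintype.card ι := by
    simp [natDegree_prod_of_monic _ _ fun i _ => monic_X_sub_C (r i)]
  have hroots : (∏ i, (X - C (r i))).roots = Finset.univ.val.map r := by
    rw [Polynomial.roots_prod]
    · simp
    · exact Finset.prod_ne_zero_iff.mpr fun i _ => X_sub_C_ne_zero _
  have h := resultant_eq_prod_eval (∏ i, (X - C (r i))) (derivative (∏ i, (X - C (r i))))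
    (Fintype.card ι - 1) (by rw [← hdeg]; exact natDegree_derivative_le _)
    (Splits.prod fun i _ => Splits.X_sub_C _)
  rw [hdeg, (monic_prod_of_monic _ _ fun i _ => monic_X_sub_C (r i)).leadingCoeff, hroots] at h
  rw [h, one_pow, one_mul, Multiset.map_map]
  exact Finset.prod_congr rfl fun i _ => eval_derivative_prod_X_sub_C r i

lemma sum_card_Ioi (m : ℕ) : ∑ i : Fin m, (Finset.Ioi i).card = m * (m - 1) / 2 := by
  simp only [Fin.card_Ioi]
  rw [← Finset.sum_range_id, ← Finset.sum_range_reflect, Finset.sum_range]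

/-- The discriminant of a product of linear factors. -/
theorem discr_prod_X_sub_C {K : Type*} [Field K] {m : ℕ} (r : Fin m → K) :
    (∏ i, (X - C (r i))).discr = (Matrix.vandermonde r).det ^ 2 := by
  rcases Nat.eq_zero_or_pos m with rfl | hm
  · simp [discr_one_eq]
  have hdeg : (∏ i, (X - C (r i))).natDegree = m := by
    simp [natDegree_prod_of_monic _ _ fun i _ => monic_X_sub_C (r i)]
  have h := resultant_deriv (f := ∏ i, (X - C (r i)))
    (natDegree_pos_iff_degree_pos.mp (hdeg.symm ▸ hm))
  have h' := resultant_derivative_prod_X_sub_C r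
  rw [Fintype.card_fin] at h'
  rw [hdeg, h', (monic_prod_of_monic _ _ fun i _ => monic_X_sub_C (r i)).leadingCoeff, mul_one]
    at h
  refine (isUnit_one.neg.pow _).mul_left_cancel (h.symm.trans ?_)
  rw [Matrix.det_vandermonde, ← sum_card_Ioi, ← Finset.prod_pow_eq_pow_sum, ← Finset.prod_pow,
    ← Finset.prod_mul_distrib]
  have := Finset.prod_prod_Ioi_mul_eq_prod_prod_off_diag (fun i j => r j - r i)
  rw [← this]
  refine Finset.prod_congr rfl fun i _ => ?_
  rw [← Finset.prod_pow, ← Finset.prod_const, ← Finset.prod_mul_distrib]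
  exact Finset.prod_congr rfl fun j _ => by ring

/-- Up to sign, the discriminant is the product of the values of the derivative at the roots. -/
theorem Monic.discr_sq_eq {K : Type*} [Field K] {f : K[X]} (hf : f.Monic) (hs : f.Splits) :
    f.discr ^ 2 = (f.roots.map f.derivative.eval).prod ^ 2 := by
  rcases Nat.eq_zero_or_pos f.natDegree with h0 | hpos
  · rw [hf.natDegree_eq_zero.mp h0]
    simp [discr_one_eq]
  have h := resultant_eq_prod_eval f f.derivative (f.natDegree - 1) (natDegree_derivative_le _) hs
  rw [resultant_deriv (natDegree_pos_iff_degree_pos.mp hpos), hf.leadingCoeff, one_pow, one_mul,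
    mul_one] at h
  rw [← h, mul_pow, ← pow_mul, mul_comm _ 2, pow_mul]
  simp

end Polynomial

/-! ### The discriminant of a symmetric integer matrix through power traces. -/

namespace Matrix

variable {ι : Type*} [Fintype ι] [DecidableEq ι]

/-- The traces of powers of an integer symmetric matrix, as a Hankel matrix. -/
noncomputable def tracePowMatrix (M : Matrix ι ι ℤ) :
    Matrix (Fin (Fintype.card ι)) (Fin (Fintype.card ι)) ℤ :=
  of fun i j => (M ^ (i + j : ℕ)).trace

lemma exists_charpoly_eq_prod_and_trace_pow {M : Matrix ι ι ℤ} (hM : M.IsSymm) :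
    ∃ r : Fin (Fintype.card ι) → ℝ,
      M.charpoly.map (Int.castRingHom ℝ) = ∏ i, (X - C (r i)) ∧
      ∀ k : ℕ, ((M ^ k).trace : ℝ) = ∑ i, r i ^ k := by
  have hA : (M.map (Int.castRingHom ℝ)).IsHermitian := by
    ext i j
    simp [hM.apply j i]
  let e := Fintype.equivFin ι
  refine ⟨fun i => hA.eigenvalues (e.symm i), ?_, fun k => ?_⟩
  · rw [← charpoly_map, hA.charpoly_eq]
    exact (Equiv.prod_comp e.symm fun i => X - C (hA.eigenvalues i)).symm
  · have h1 : ((M ^ k).trace : ℝ) = ((M.map (Int.castRingHom ℝ)) ^ k).trace := by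
      have : (M.map (Int.castRingHom ℝ)) ^ k = (M ^ k).map (Int.castRingHom ℝ) :=
        (map_pow (Int.castRingHom ℝ).mapMatrix M k).symm
      rw [this]
      simp [trace]
    rw [h1, Equiv.sum_comp e.symm fun i => hA.eigenvalues i ^ k]
    conv_lhs => rw [hA.spectral_theorem, ← map_pow, Unitary.conjStarAlgAut_apply, trace_mul_cycle,
      Unitary.coe_star_mul_self, one_mul, diagonal_pow, trace_diagonal]
    simp

/-- Over the real eigenvalues the Hankel matrix of power traces factors as `VᵀV` with `V`
Vandermonde. -/
theorem discr_charpoly_eq_det_tracePowMatrix {M : Matrix ι ι ℤ} (hM : M.IsSymm) :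
    M.charpoly.discr = M.tracePowMatrix.det := by
  obtain ⟨r, hr, htr⟩ := exists_charpoly_eq_prod_and_trace_pow hM
  have h := M.charpoly_monic.discr_map (Int.castRingHom ℝ)
  rw [hr, discr_prod_X_sub_C] at h
  have h2 : M.tracePowMatrix.map (Int.castRingHom ℝ) = (vandermonde r)ᵀ * vandermonde r := by
    ext i j
    simp [tracePowMatrix, mul_apply, htr (i + j), ← pow_add]
  have h3 : (Int.castRingHom ℝ) M.tracePowMatrix.det = (vandermonde r).det ^ 2 := by
    rw [RingHom.map_det, RingHom.mapMatrix_apply, h2, det_mul, det_transpose, sq]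
  exact Int.cast_injective (α := ℝ) (h.symm.trans h3.symm)

theorem discr_charpoly_nonneg {M : Matrix ι ι ℤ} (hM : M.IsSymm) : 0 ≤ M.charpoly.discr := by
  obtain ⟨r, hr, -⟩ := exists_charpoly_eq_prod_and_trace_pow hM
  have h := M.charpoly_monic.discr_map (Int.castRingHom ℝ)
  rw [hr, discr_prod_X_sub_C] at h
  have : (0 : ℝ) ≤ (Int.castRingHom ℝ) M.charpoly.discr := h ▸ sq_nonneg _
  rw [eq_intCast] at this
  exact_mod_cast this

end Matrix

/-! ### Determinants with a null vector modulo `q`, and matrices nilpotent modulo `q`. -/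

namespace Matrix

lemma dvd_det_of_dvd_col {ι R : Type*} [Fintype ι] [DecidableEq ι] [CommRing R]
    (N : Matrix ι ι R) (q : R) (j : ι) (h : ∀ i, q ∣ N i j) : q ∣ N.det := by
  choose c hc using h
  have : N = N.updateCol j (q • c) := by
    ext a b
    by_cases hb : b = j
    · subst hb; simp [hc]
    · simp [hb]
  rw [this, det_updateCol_smul]
  exact dvd_mul_right _ _

/-- Extract one `q` from column `j` and another from row `j`; the diagonal entry is hit twice, hence
needs `q ^ 2`. -/
lemma sq_dvd_det_of_dvd_row_col {ι R : Type*} [Fintype ι] [DecidableEq ι] [CommRing R]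
    (N : Matrix ι ι R) (q : R) (j : ι) (hcol : ∀ i, q ∣ N i j) (hrow : ∀ i, q ∣ N j i)
    (hd : q ^ 2 ∣ N j j) : q ^ 2 ∣ N.det := by
  choose c hc using hcol
  obtain ⟨d, hd⟩ := hd
  have h1 : N = N.updateCol j (q • (fun i => if i = j then q * d else c i)) := by
    ext a b
    by_cases hb : b = j
    · subst hb
      by_cases ha : a = b
      · subst ha; simp [hd]; ring
      · simp [hc, ha]
    · simp [hb]
  rw [h1, det_updateCol_smul, sq]
  refine mul_dvd_mul_left _ ?_
  rw [← det_transpose]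
  refine dvd_det_of_dvd_col _ q j fun i => ?_
  by_cases hi : i = j
  · simp [hi]
  · simpa [hi] using hrow i

/-- A symmetric integer matrix with a nontrivial null vector modulo `q` whose quadratic form value
vanishes modulo `q ^ 2` has determinant divisible by `q ^ 2`. -/
theorem sq_dvd_det_of_null_vector {ι : Type*} [Fintype ι] [DecidableEq ι]
    {G : Matrix ι ι ℤ} (hG : G.IsSymm) {q : ℤ} (hq : Prime q) (t : ι → ℤ)
    (h1 : ∀ i, q ∣ (G *ᵥ t) i) (h2 : q ^ 2 ∣ t ⬝ᵥ G *ᵥ t) {j : ι} (hj : ¬ q ∣ t j) :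
    q ^ 2 ∣ G.det := by
  -- The congruence `PᵀGP` moves `t` to the basis vector `j`, and `det P = t j` is prime to `q`.
  let P : Matrix ι ι ℤ := (1 : Matrix ι ι ℤ).updateCol j t
  have hP : P.det = t j := by
    have : P.det = cramer (1 : Matrix ι ι ℤ) t j := by rw [cramer_apply]
    rw [this, cramer_one]; rfl
  have hPj : P *ᵥ Pi.single j 1 = t := by
    ext i; simp [P]
  have hN : ∀ a b, (Pᵀ * G * P) a b = (P *ᵥ Pi.single a 1) ⬝ᵥ G *ᵥ (P *ᵥ Pi.single b 1) := by
    intro a b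
    rw [mulVec_mulVec, mulVec_single_one, mulVec_single_one]
    rw [Matrix.mul_assoc]
    simp [Matrix.mul_apply, dotProduct, col]
  have hdet : (Pᵀ * G * P).det = t j ^ 2 * G.det := by
    rw [det_mul, det_mul, det_transpose, hP]; ring
  have hdvd : q ^ 2 ∣ (Pᵀ * G * P).det := by
    refine sq_dvd_det_of_dvd_row_col _ q j (fun i => ?_) (fun i => ?_) ?_
    · rw [hN, hPj]
      exact Finset.dvd_sum fun k _ => (h1 k).mul_left _
    · rw [hN, hPj, dotProduct_mulVec, ← mulVec_transpose, hG.eq]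
      exact Finset.dvd_sum fun k _ => (h1 k).mul_right _
    · rw [hN, hPj]; exact h2
  rw [hdet] at hdvd
  have hcop : IsCoprime (q ^ 2) (t j ^ 2) :=
    IsCoprime.pow ((Prime.coprime_iff_not_dvd hq).mpr hj)
  exact hcop.dvd_of_dvd_mul_left hdvd

variable {ι : Type*} [Fintype ι] [DecidableEq ι]

lemma natCast_dvd_trace_of_isNilpotent {q : ℕ} [Fact q.Prime] {C : Matrix ι ι ℤ}
    (h : IsNilpotent (C.map (Int.castRingHom (ZMod q)))) : (q : ℤ) ∣ C.trace := by
  have := (isNilpotent_trace_of_isNilpotent h).eq_zero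
  rw [← ZMod.intCast_zmod_eq_zero_iff_dvd, ← this]
  simp [trace]

/-- The trace of the square of an integer matrix that is nilpotent modulo `2` vanishes
modulo `4`. -/
lemma four_dvd_trace_sq {C : Matrix ι ι ℤ}
    (h : IsNilpotent (C.map (Int.castRingHom (ZMod 2)))) : (4 : ℤ) ∣ (C ^ 2).trace := by
  have hone := det_one_add_X_smul (R := ℤ) (n := ι)
  -- Compare the coefficients of `X²` in `det(1 + XC) det(1 - XC) = det(1 - X²C²)`: `tr C² = (tr C)²
  -- - 2e₂`. Nilpotency modulo 2 makes both `tr C` and `e₂` even.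
  have h1 : (1 + (X : ℤ[X]) • C.map Polynomial.C) * (1 + (X : ℤ[X]) • (-C).map Polynomial.C) =
      (1 + (X : ℤ[X]) • (-(C ^ 2)).map Polynomial.C).map (Polynomial.expand ℤ 2) := by
    have e1 : (-C).map Polynomial.C = -(C.map Polynomial.C) := by ext; simp
    have e2 : (C ^ 2).map Polynomial.C = C.map Polynomial.C * C.map Polynomial.C := by
      rw [sq, Matrix.map_mul]
    have e3 : (1 + (X : ℤ[X]) • (-(C ^ 2)).map Polynomial.C).map (Polynomial.expand ℤ 2) =
        1 - (X ^ 2 : ℤ[X]) • (C ^ 2).map Polynomial.C := by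
      ext1 i j
      by_cases hij : i = j <;> simp [hij, sub_eq_add_neg]
    rw [e1, e3, e2]
    simp only [mul_add, add_mul, mul_one, one_mul, smul_mul_assoc, mul_smul_comm, smul_smul,
      mul_neg, smul_neg, smul_add, sq]
    abel
  have h2 := congrArg det h1
  have h3 : ∀ N : Matrix ι ι ℤ[X], (N.map (Polynomial.expand ℤ 2)).det =
      Polynomial.expand ℤ 2 N.det := fun N => (AlgHom.map_det (Polynomial.expand ℤ 2) N).symm
  rw [det_mul, h3] at h2
  have hrev : ∀ k, 0 < k → (2 : ℤ) ∣ (det (1 + (X : ℤ[X]) • (-C).map Polynomial.C)).coeff k := by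
    intro k hk
    have hu := isUnit_charpolyRev_of_isNilpotent h
    have hz : ((C.map (Int.castRingHom (ZMod 2))).charpolyRev).coeff k = 0 := by
      obtain ⟨r, -, hr⟩ := Polynomial.isUnit_iff.mp hu
      rw [← hr, coeff_C, if_neg hk.ne']
    have hm : (det (1 + (X : ℤ[X]) • (-C).map Polynomial.C)).map (Int.castRingHom (ZMod 2)) =
        (C.map (Int.castRingHom (ZMod 2))).charpolyRev := by
      rw [charpolyRev, ← coe_mapRingHom, RingHom.map_det]
      congr 1
      ext1 i j
      by_cases hij : i = j <;> simp [hij, sub_eq_add_neg]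
    rw [← hm, coeff_map, eq_intCast] at hz
    exact_mod_cast (ZMod.intCast_zmod_eq_zero_iff_dvd _ 2).mp hz
  have hcoef := congrArg (fun f => f.coeff 2) h2
  have hL : ∀ N : Matrix ι ι ℤ, (det (1 + (X : ℤ[X]) • N.map Polynomial.C)).coeff 0 = 1 := by
    intro N; rw [hone]; simp [coeff_one]
  have hL1 : ∀ N : Matrix ι ι ℤ,
      (det (1 + (X : ℤ[X]) • N.map Polynomial.C)).coeff 1 = N.trace := by
    intro N; rw [coeff_det_one_add_X_smul_one]
  have hsub : (det (1 + (X : ℤ[X]) • C.map Polynomial.C)).coeff 2 =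
      (det (1 + (X : ℤ[X]) • (-C).map Polynomial.C)).coeff 2 := by
    have : (det (1 + (X : ℤ[X]) • (-C).map Polynomial.C)).comp (-X) =
        det (1 + (X : ℤ[X]) • C.map Polynomial.C) := by
      rw [← coe_compRingHom_apply, RingHom.map_det]
      congr 1
      ext1 i j
      by_cases hij : i = j <;> simp [hij]
    rw [← this, show (-X : ℤ[X]) = Polynomial.C (-1) * X by simp, comp_C_mul_X_coeff]
    simp
  rw [show 2 = 1 * 2 from rfl, coeff_expand_mul (by norm_num), hL1, coeff_mul] at hcoef
  simp only [Finset.Nat.antidiagonal_succ, Finset.Nat.antidiagonal_zero, one_mul] at hcoef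
  simp [hL, hL1, hsub] at hcoef
  obtain ⟨a, ha⟩ := hrev 1 one_pos
  obtain ⟨b, hb⟩ := hrev 2 two_pos
  rw [hL1, trace_neg] at ha
  rw [hb] at hcoef
  refine ⟨a ^ 2 - b, ?_⟩
  have : C.trace = -(2 * a) := by linarith
  rw [this] at hcoef
  linarith [hcoef, sq a]

end Matrix

/-! ### Reduction modulo `q` in `ℤ[X]` and in `ℤ[X] / p`. -/

namespace Polynomial

lemma natCast_dvd_iff_map_eq_zero (q : ℕ) (f : ℤ[X]) :
    (q : ℤ[X]) ∣ f ↔ f.map (Int.castRingHom (ZMod q)) = 0 := by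
  rw [show (q : ℤ[X]) = C (q : ℤ) by simp, C_dvd_iff_dvd_coeff, Polynomial.ext_iff]
  simp [ZMod.intCast_zmod_eq_zero_iff_dvd]

lemma exists_eq_mul_add_of_map_dvd {q : ℕ} {p f : ℤ[X]}
    (h : p.map (Int.castRingHom (ZMod q)) ∣ f.map (Int.castRingHom (ZMod q))) :
    ∃ g k, f = p * g + q * k := by
  obtain ⟨g', hg'⟩ := h
  obtain ⟨g, rfl⟩ := Polynomial.map_surjective (Int.castRingHom (ZMod q)) (ZMod.ringHom_surjective _) g'
  have : (q : ℤ[X]) ∣ f - p * g := by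
    rw [natCast_dvd_iff_map_eq_zero, Polynomial.map_sub, Polynomial.map_mul, hg', sub_self]
  obtain ⟨k, hk⟩ := this
  exact ⟨g, k, by rw [← hk]; ring⟩

lemma Monic.discr_ne_zero_iff_separable {K : Type*} [Field K] {f : K[X]} (hf : f.Monic) :
    f.discr ≠ 0 ↔ f.Separable := by
  rcases Nat.eq_zero_or_pos f.natDegree with h0 | hpos
  · rw [hf.natDegree_eq_zero.mp h0]
    simp [discr_one_eq, separable_one]
  have h := resultant_deriv (natDegree_pos_iff_degree_pos.mp hpos)
  -- In positive characteristic the derivative may have degree below `n - 1`; the excess `k`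
  -- contributes only powers of the leading coefficient 1.
  obtain ⟨k, hk⟩ := Nat.exists_eq_add_of_le (natDegree_derivative_le f)
  rw [hk, resultant_add_right_deg _ _ _ _ _ le_rfl, hf.coeff_natDegree, hf.leadingCoeff,
    one_pow, mul_one, one_mul] at h
  rw [Separable, ← isUnit_resultant_iff_isCoprime hf, isUnit_iff_ne_zero, h]
  simp

end Polynomial

namespace AdjoinRoot

lemma natCast_dvd_mk_iff {p f : ℤ[X]} {c : ℕ} :
    (c : AdjoinRoot p) ∣ mk p f ↔ ∃ g h, f = p * g + c * h := by
  constructor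
  · rintro ⟨s, hs⟩
    obtain ⟨h, rfl⟩ := mk_surjective s
    rw [← map_natCast (mk p), ← map_mul, mk_eq_mk] at hs
    obtain ⟨g, hg⟩ := hs
    exact ⟨g, h, by rw [← hg]; ring⟩
  · rintro ⟨g, h, rfl⟩
    exact ⟨mk p h, by simp⟩

lemma natCast_mul_left_cancel {p : ℤ[X]} (hp : p.Monic) {c : ℕ} (hc : c ≠ 0)
    {s t : AdjoinRoot p} (h : (c : AdjoinRoot p) * s = c * t) : s = t := by
  have : Module.Free ℤ (AdjoinRoot p) := hp.free_adjoinRoot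
  rw [← Int.cast_natCast, ← zsmul_eq_mul, ← zsmul_eq_mul] at h
  exact smul_right_injective (AdjoinRoot p) (Int.natCast_ne_zero.mpr hc) h

/-- If the discriminant of `p` is a unit modulo `q`, then `ℤ[X] / p` is reduced modulo `q`. -/
theorem dvd_of_dvd_sq {p : ℤ[X]} (hp : p.Monic) {q : ℕ} [Fact q.Prime]
    (hd : ¬ (q : ℤ) ∣ p.discr) {t : AdjoinRoot p} (ht : (q : AdjoinRoot p) ∣ t ^ 2) :
    (q : AdjoinRoot p) ∣ t := by
  obtain ⟨f, rfl⟩ := mk_surjective t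
  rw [← map_pow, natCast_dvd_mk_iff] at ht
  obtain ⟨g, h, hgh⟩ := ht
  have hsep : (p.map (Int.castRingHom (ZMod q))).Separable := by
    rw [← (hp.map _).discr_ne_zero_iff_separable, hp.discr_map, eq_intCast, Ne,
      ZMod.intCast_zmod_eq_zero_iff_dvd]
    exact hd
  rw [natCast_dvd_mk_iff]
  refine exists_eq_mul_add_of_map_dvd ?_
  refine (hsep.squarefree.dvd_pow_iff_dvd two_ne_zero).mp ?_
  refine ⟨g.map (Int.castRingHom (ZMod q)), ?_⟩
  rw [← Polynomial.map_pow, hgh]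
  simp

end AdjoinRoot

/-! ### The trace form on `ℤ[X] / p`. -/

namespace Matrix

variable {ι : Type*} [Fintype ι] [DecidableEq ι]

lemma aeval_eq_sum_fin {M : Matrix ι ι ℤ} {f : ℤ[X]} (hf : f.degree < Fintype.card ι) :
    aeval M f = ∑ j : Fin (Fintype.card ι), f.coeff j • M ^ (j : ℕ) := by
  rcases Nat.eq_zero_or_pos (Fintype.card ι) with h0 | hpos
  · have : IsEmpty ι := Fintype.card_eq_zero_iff.mp h0
    exact Subsingleton.elim _ _
  · have hlt : f.natDegree < Fintype.card ι := by
      by_cases hf0 : f = 0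
      · simpa [hf0] using hpos
      · exact (natDegree_lt_iff_degree_lt hf0).mpr hf
    rw [aeval_eq_sum_range' hlt,
      Finset.sum_range]

/-- The Hankel matrix is the Gram matrix of `(g, h) ↦ tr (g(M) h(M))` in the basis of powers of `X`.
-/
lemma tracePowMatrix_mulVec {M : Matrix ι ι ℤ} {f : ℤ[X]} (hf : f.degree < Fintype.card ι)
    (i : Fin (Fintype.card ι)) :
    (M.tracePowMatrix *ᵥ fun j => f.coeff j) i = (M ^ (i : ℕ) * aeval M f).trace := by
  rw [aeval_eq_sum_fin hf, Finset.mul_sum, trace_sum]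
  simp only [mulVec, dotProduct, tracePowMatrix, of_apply, pow_add, mul_smul_comm, trace_smul,
    smul_eq_mul, mul_comm]

lemma dotProduct_tracePowMatrix_mulVec {M : Matrix ι ι ℤ} {f : ℤ[X]}
    (hf : f.degree < Fintype.card ι) :
    ((fun j : Fin (Fintype.card ι) => f.coeff j) ⬝ᵥ M.tracePowMatrix *ᵥ fun j => f.coeff j) =
      (aeval M f ^ 2).trace := by
  rw [sq]
  nth_rw 1 [aeval_eq_sum_fin hf]
  rw [Finset.sum_mul, trace_sum]
  simp only [dotProduct, tracePowMatrix_mulVec hf, smul_mul_assoc, trace_smul, smul_eq_mul]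

lemma map_aeval_castRingHom (q : ℕ) (M : Matrix ι ι ℤ) (f : ℤ[X]) :
    (aeval M f).map (Int.castRingHom (ZMod q)) =
      aeval (M.map (Int.castRingHom (ZMod q))) (f.map (Int.castRingHom (ZMod q))) := by
  have := Polynomial.hom_eval₂ f (algebraMap ℤ (Matrix ι ι ℤ))
    (Int.castRingHom (ZMod q)).mapMatrix M
  rw [aeval_def, aeval_def, eval₂_map]
  refine Eq.trans this ?_
  congr 1
  exact Subsingleton.elim _ _

/-- A polynomial expression in a symmetric integer matrix that is nilpotent modulo a prime `q`
forces the discriminant to be divisible by `q ^ 2`. -/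
theorem sq_dvd_discr_charpoly {M : Matrix ι ι ℤ} (hM : M.IsSymm) {q : ℕ} [hq : Fact q.Prime]
    {f : ℤ[X]} (hf : f.degree < Fintype.card ι)
    (hnil : IsNilpotent ((aeval M f).map (Int.castRingHom (ZMod q))))
    (htr : (q : ℤ) ^ 2 ∣ (aeval M f ^ 2).trace) (hne : ¬ (q : ℤ[X]) ∣ f) :
    (q : ℤ) ^ 2 ∣ M.charpoly.discr := by
  rw [discr_charpoly_eq_det_tracePowMatrix hM]
  have hsymm : M.tracePowMatrix.IsSymm := by
    ext i j
    simp [tracePowMatrix, add_comm]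
  have hj : ∃ j : Fin (Fintype.card ι), ¬ (q : ℤ) ∣ f.coeff j := by
    by_contra! hall
    apply hne
    rw [show (q : ℤ[X]) = C (q : ℤ) by simp, C_dvd_iff_dvd_coeff]
    intro i
    by_cases hi : i < Fintype.card ι
    · exact hall ⟨i, hi⟩
    · rw [coeff_eq_zero_of_degree_lt (hf.trans_le (by exact_mod_cast not_lt.mp hi))]
      exact dvd_zero _
  obtain ⟨j, hj⟩ := hj
  -- The coefficient vector of `f` is null modulo `q`: each `Mⁱ f(M)` is nilpotent modulo `q`, so
  -- its trace vanishes there.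
  refine sq_dvd_det_of_null_vector hsymm (Nat.prime_iff_prime_int.mp hq.out)
    (fun j => f.coeff j) (fun i => ?_) ?_ hj
  · rw [tracePowMatrix_mulVec hf]
    refine natCast_dvd_trace_of_isNilpotent ?_
    rw [Matrix.map_mul]
    refine Commute.isNilpotent_mul_left ?_ hnil
    have h := map_aeval_castRingHom q M (X ^ (i : ℕ))
    rw [map_pow, aeval_X] at h
    rw [h, map_aeval_castRingHom]
    exact (Commute.all _ _).map (aeval _)
  · rw [dotProduct_tracePowMatrix_mulVec hf]
    exact htr

end Matrix

namespace AdjoinRoot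

/-- If the discriminant of the characteristic polynomial `p` of a symmetric integer matrix is not
divisible by `q ^ 2`, then `ℤ[X] / p` is integrally closed at `q`, tested on squares. -/
theorem dvd_of_sq_dvd_sq {ι : Type*} [Fintype ι] [DecidableEq ι] {M : Matrix ι ι ℤ}
    (hM : M.IsSymm) {q : ℕ} [Fact q.Prime] (hd : ¬ (q : ℤ) ^ 2 ∣ M.charpoly.discr)
    {t : AdjoinRoot M.charpoly} (ht : (q : AdjoinRoot M.charpoly) ^ 2 ∣ t ^ 2) :
    (q : AdjoinRoot M.charpoly) ∣ t := by
  obtain ⟨f', rfl⟩ := mk_surjective t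
  obtain ⟨f, hf, hff'⟩ : ∃ f : ℤ[X], f.degree < Fintype.card ι ∧
      mk M.charpoly f = mk M.charpoly f' := by
    refine ⟨f' %ₘ M.charpoly, ?_, ?_⟩
    · simpa using degree_modByMonic_lt f' M.charpoly_monic
    · rw [mk_eq_mk, ← dvd_neg, neg_sub]
      exact ⟨_, sub_eq_of_eq_add' (modByMonic_add_div f' M.charpoly).symm⟩
  rw [← hff'] at ht ⊢
  by_contra hne
  have hne' : ¬ (q : ℤ[X]) ∣ f := fun ⟨g, hg⟩ => hne ⟨mk _ g, by rw [hg]; simp⟩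
  rw [← Nat.cast_pow, ← map_pow, natCast_dvd_mk_iff] at ht
  obtain ⟨g, h, hgh⟩ := ht
  have hsq : aeval M f ^ 2 = (q : ℤ) ^ 2 • aeval M h := by
    rw [← map_pow, hgh]
    simp [Matrix.aeval_self_charpoly, zsmul_eq_mul]
  refine hd (Matrix.sq_dvd_discr_charpoly hM hf ⟨2, ?_⟩ ?_ hne')
  · rw [← RingHom.mapMatrix_apply, ← map_pow, hsq]
    ext i j
    rw [RingHom.mapMatrix_apply, Matrix.map_apply, Matrix.smul_apply]
    simp
  · rw [hsq, Matrix.trace_smul]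
    exact ⟨_, rfl⟩

end AdjoinRoot

/-- The discriminant of the characteristic polynomial of a symmetric integer matrix is divisible by
`4` as soon as it is even. -/
theorem Matrix.four_dvd_discr_charpoly {ι : Type*} [Fintype ι] [DecidableEq ι] {M : Matrix ι ι ℤ}
    (hM : M.IsSymm) (h2 : (2 : ℤ) ∣ M.charpoly.discr) : (4 : ℤ) ∣ M.charpoly.discr := by
  have hmon := M.charpoly_monic.map (Int.castRingHom (ZMod 2))
  have hns : ¬ Squarefree (M.charpoly.map (Int.castRingHom (ZMod 2))) := by
    rw [← PerfectField.separable_iff_squarefree, ← hmon.discr_ne_zero_iff_separable,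
      M.charpoly_monic.discr_map, not_not, eq_intCast]
    exact (ZMod.intCast_zmod_eq_zero_iff_dvd _ 2).mpr h2
  simp only [Squarefree, not_forall] at hns
  -- Modulo 2 the polynomial is `g²k` with `g` not a unit. Then `gk` is nonzero of smaller degree,
  -- while `p` divides its square.
  obtain ⟨g, ⟨k, hk⟩, hg⟩ := hns
  have hk0 : g * k ≠ 0 := by
    intro h0
    rw [mul_assoc, h0, mul_zero] at hk
    exact hmon.ne_zero hk
  have hdeg : (g * k).degree < Fintype.card ι := by
    have h1 : (M.charpoly.map (Int.castRingHom (ZMod 2))).degree = Fintype.card ι := by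
      rw [M.charpoly_monic.degree_map, M.charpoly_degree_eq_dim]
    rw [← h1, hk, mul_assoc, degree_mul (p := g) (q := g * k), degree_eq_natDegree hk0,
      degree_eq_natDegree (left_ne_zero_of_mul hk0)]
    have : 0 < g.natDegree := by
      rw [Nat.pos_iff_ne_zero]
      intro h0
      rw [eq_C_of_natDegree_eq_zero h0, isUnit_C, isUnit_iff_ne_zero] at hg
      apply left_ne_zero_of_mul hk0
      rw [eq_C_of_natDegree_eq_zero h0, not_not.mp hg, C_0]
    norm_cast
    omega
  obtain ⟨f, hf, hfd⟩ := exists_degree_eq_of_mem_lifts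
    (Polynomial.map_surjective (Int.castRingHom (ZMod 2)) (ZMod.ringHom_surjective _) (g * k))
  have hnil : IsNilpotent ((aeval M f).map (Int.castRingHom (ZMod 2))) := by
    refine ⟨2, ?_⟩
    rw [map_aeval_castRingHom, hf, ← map_pow, show (g * k) ^ 2 = (g * g * k) * k by ring, ← hk,
      ← charpoly_map, map_mul, aeval_self_charpoly, zero_mul]
  refine sq_dvd_discr_charpoly (q := 2) hM (hfd ▸ hdeg) hnil ?_ ?_
  -- Here `f(M)²` is only known to vanish modulo 2, so divisibility of its trace by 4 has to come
  -- from nilpotency.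
  · exact four_dvd_trace_sq hnil
  · rw [natCast_dvd_iff_map_eq_zero, hf]
    exact hk0

/-! ### From `p(x)` to `p(x²)` and `x p(x²)`. -/

namespace Polynomial

lemma exists_eq_expand_add_X_mul_expand {R : Type*} [CommRing R] (f : R[X]) :
    ∃ a b : R[X], f = expand R 2 a + X * expand R 2 b := by
  induction f using Polynomial.induction_on' with
  | add f g hf hg =>
    obtain ⟨a, b, rfl⟩ := hf
    obtain ⟨c, d, rfl⟩ := hg
    exact ⟨a + c, b + d, by simp only [map_add]; ring⟩
  | monomial n r =>
    rcases Nat.even_or_odd' n with ⟨k, rfl | rfl⟩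
    · exact ⟨monomial k r, 0, by simp [expand_monomial, mul_comm]⟩
    · refine ⟨0, monomial k r, ?_⟩
      rw [map_zero, zero_add, expand_monomial, X_mul_monomial, mul_comm]

lemma expand_add_X_mul_expand_inj {R : Type*} [CommRing R] {a b c d : R[X]}
    (h : expand R 2 a + X * expand R 2 b = expand R 2 c + X * expand R 2 d) : a = c ∧ b = d := by
  constructor
  · ext k
    have := congrArg (fun f => f.coeff (k * 2)) h
    cases k with
    | zero => simpa [coeff_expand two_pos] using this
    | succ k =>
      have h2 : ¬ 2 ∣ k * 2 + 1 := by omega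
      rw [coeff_add, coeff_add, coeff_expand_mul two_pos, coeff_expand_mul two_pos,
        show (k + 1) * 2 = (k * 2 + 1) + 1 by ring, coeff_X_mul, coeff_X_mul,
        coeff_expand two_pos, coeff_expand two_pos, if_neg h2, if_neg h2] at this
      simpa using this
  · ext k
    have := congrArg (fun f => f.coeff (k * 2 + 1)) h
    have h2 : ¬ 2 ∣ k * 2 + 1 := by omega
    rw [coeff_add, coeff_add, coeff_X_mul, coeff_X_mul, coeff_expand_mul two_pos,
      coeff_expand_mul two_pos, coeff_expand two_pos, coeff_expand two_pos, if_neg h2,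
      if_neg h2] at this
    simpa using this

end Polynomial

/-- In a ring where `q` is a nonzerodivisor at which squares detect divisibility, a quadratic
relation over `y` forces both coordinates to be divisible by `q`. -/
lemma dvd_and_dvd_of_sq_add_mul_sq {S : Type*} [CommRing S] {q : ℕ} (hq : q.Prime)
    (hcancel : ∀ s t : S, (q : S) * s = q * t → s = t)
    (hI : ∀ t : S, (q : S) ^ 2 ∣ t ^ 2 → (q : S) ∣ t)
    (hII : q = 2 → ∀ t : S, (q : S) ∣ t ^ 2 → (q : S) ∣ t)
    {y z : S} (hyz : z * y = 1) {a b : S} (h1 : (q : S) ^ 2 ∣ a ^ 2 + y * b ^ 2)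
    (h2 : (q : S) ^ 2 ∣ 2 * (a * b)) : (q : S) ∣ a ∧ (q : S) ∣ b := by
  obtain ⟨s, hs⟩ := h1
  obtain ⟨r, hr⟩ := h2
  suffices ha : (q : S) ∣ a by
    refine ⟨ha, hI b ?_⟩
    obtain ⟨a', rfl⟩ := ha
    refine ⟨z * (s - a' ^ 2), ?_⟩
    linear_combination z * hs - b ^ 2 * hyz
  rcases hq.eq_two_or_odd' with rfl | ⟨k, hk⟩
  -- For `q = 2`, multiplying the first relation by `a²` and using `ab = 2r` gives `4 ∣ a⁴`;
  -- reducedness modulo 2 is then applied twice.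
  · have hr' : a * b = 2 * r := hcancel _ _ (by push_cast at hr ⊢; linear_combination hr)
    refine hII rfl _ (hII rfl _ ⟨2 * (s * a ^ 2 - y * r ^ 2), ?_⟩)
    push_cast at hs ⊢
    linear_combination a ^ 2 * hs - y * (a * b + 2 * r) * hr'
  · have hodd : (q : S) ^ 2 = 2 * (2 * k ^ 2 + 2 * k) + 1 := by
      rw [hk]; push_cast; ring
    have half : ∀ u v : S, 2 * u = (q : S) ^ 2 * v →
        u = (q : S) ^ 2 * (u - (2 * k ^ 2 + 2 * k) * v) := by
      intro u v huv
      linear_combination (-u) * hodd - (2 * (k : S) ^ 2 + 2 * k) * huv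
    obtain ⟨c, hc⟩ : ∃ c, a * b = (q : S) ^ 2 * c := ⟨_, half _ _ hr⟩
    -- The element squared is `a² - yb²`, and `(a² - yb²)² = (a² + yb²)² - 4y(ab)²`. Extracting `q`
    -- twice gives `q² ∣ a² - yb²`, hence `q² ∣ 2a²`.
    have hT : (2 * a ^ 2 - (q : S) ^ 2 * s) ^ 2 = (q : S) ^ 4 * (s ^ 2 - 4 * y * c ^ 2) := by
      linear_combination 4 * a ^ 2 * hs - 4 * y * (a * b + (q : S) ^ 2 * c) * hc
    obtain ⟨T1, hT1⟩ := hI (2 * a ^ 2 - (q : S) ^ 2 * s)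
      ⟨(q : S) ^ 2 * (s ^ 2 - 4 * y * c ^ 2), by rw [hT]; ring⟩
    obtain ⟨T2, hT2⟩ := hI T1 ⟨s ^ 2 - 4 * y * c ^ 2, by
      refine hcancel _ _ (hcancel _ _ ?_)
      rw [hT1] at hT
      linear_combination hT⟩
    refine hI a ⟨_, half _ (T2 + s) ?_⟩
    rw [hT2] at hT1
    linear_combination hT1

namespace Polynomial

/-- Squares detect divisibility by `q` in `ℤ[X] / χ`. -/
def SqDetects (χ : ℤ[X]) (q : ℕ) : Prop :=
  ∀ f g h : ℤ[X], f ^ 2 = χ * g + (q : ℤ[X]) ^ 2 * h → ∃ g' h' : ℤ[X], f = χ * g' + q * h'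

/-- With `S = ℤ[X] / p` and `y` the class of `X`, the ring `ℤ[X] / p(X²)` is `S[√y]`. Even and odd
parts of a square are `a² + yb²` and `2ab`, and `y` is a unit because `p(0) = ±1`. -/
theorem sqDetects_expand {ι : Type*} [Fintype ι] [DecidableEq ι] {M : Matrix ι ι ℤ}
    (hM : M.IsSymm) (h0 : M.charpoly.coeff 0 = 1 ∨ M.charpoly.coeff 0 = -1) {q : ℕ}
    (hq : q.Prime) (hd : ¬ (q : ℤ) ^ 2 ∣ M.charpoly.discr) :
    (expand ℤ 2 M.charpoly).SqDetects q := by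
  have : Fact q.Prime := ⟨hq⟩
  intro f g h hf
  obtain ⟨a, b, rfl⟩ := exists_eq_expand_add_X_mul_expand f
  obtain ⟨g0, g1, rfl⟩ := exists_eq_expand_add_X_mul_expand g
  obtain ⟨r0, r1, rfl⟩ := exists_eq_expand_add_X_mul_expand h
  obtain ⟨e0, e1⟩ := expand_add_X_mul_expand_inj
    (a := a ^ 2 + X * b ^ 2) (b := 2 * (a * b))
    (c := M.charpoly * g0 + (q : ℤ[X]) ^ 2 * r0) (d := M.charpoly * g1 + (q : ℤ[X]) ^ 2 * r1) (by
      simp only [map_add, map_mul, map_pow, expand_X, map_natCast, map_ofNat]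
      linear_combination hf)
  let φ := AdjoinRoot.mk M.charpoly
  have hφ : φ M.charpoly = 0 := AdjoinRoot.mk_self
  obtain ⟨z, hz⟩ : ∃ z, z * φ X = 1 := by
    have h1 := congrArg φ (divX_mul_X_add M.charpoly)
    rw [hφ, map_add, map_mul] at h1
    rcases h0 with h0 | h0 <;> rw [h0] at h1
    · exact ⟨-φ M.charpoly.divX, by simp at h1; linear_combination -h1⟩
    · exact ⟨φ M.charpoly.divX, by simp at h1; linear_combination h1⟩
  obtain ⟨ha, hb⟩ := dvd_and_dvd_of_sq_add_mul_sq (S := AdjoinRoot M.charpoly) hq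
    (fun s t => AdjoinRoot.natCast_mul_left_cancel M.charpoly_monic hq.ne_zero)
    (fun t => AdjoinRoot.dvd_of_sq_dvd_sq hM hd)
    (fun hq2 t => AdjoinRoot.dvd_of_dvd_sq M.charpoly_monic (by
      rintro hdvd
      subst hq2
      exact hd (Matrix.four_dvd_discr_charpoly hM hdvd)))
    hz (a := φ a) (b := φ b)
    ⟨φ r0, by
      have := congrArg φ e0
      simpa [hφ] using this⟩
    ⟨φ r1, by
      have := congrArg φ e1
      simpa [hφ, map_ofNat φ 2] using this⟩
  obtain ⟨a1, a2, rfl⟩ := AdjoinRoot.natCast_dvd_mk_iff.mp ha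
  obtain ⟨b1, b2, rfl⟩ := AdjoinRoot.natCast_dvd_mk_iff.mp hb
  refine ⟨expand ℤ 2 a1 + X * expand ℤ 2 b1, expand ℤ 2 a2 + X * expand ℤ 2 b2, ?_⟩
  simp only [map_add, map_mul, map_natCast]
  ring

/-- From `f = χ g₁ + q h₁`, evaluation at 0 gives `q ∣ f(0)`, hence `q ∣ g₁(0)` as `χ(0) = ±1`; so
`g₁` is a multiple of `X` modulo `q`. -/
theorem SqDetects.X_mul {χ : ℤ[X]} {q : ℕ} (hq : q.Prime) (hχ : χ.SqDetects q)
    (h0 : χ.coeff 0 = 1 ∨ χ.coeff 0 = -1) : (X * χ).SqDetects q := by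
  intro f g h hf
  obtain ⟨g1, h1, rfl⟩ := hχ f (X * g) h (by rw [hf]; ring)
  have hqp : Prime (q : ℤ) := Nat.prime_iff_prime_int.mp hq
  have hdvd : (q : ℤ) ∣ g1.coeff 0 := by
    have e := congrArg (fun f => f.coeff 0) hf
    simp only [coeff_zero_eq_eval_zero, eval_pow, eval_add, eval_mul, eval_X, zero_mul, zero_add,
      eval_natCast] at e
    have h2 : (q : ℤ) ∣ eval 0 χ * eval 0 g1 + q * eval 0 h1 :=
      hqp.dvd_of_dvd_pow (n := 2) ⟨q * eval 0 h, by rw [e]; ring⟩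
    have h3 := (dvd_add_left (dvd_mul_right (q : ℤ) (eval 0 h1))).mp h2
    rw [coeff_zero_eq_eval_zero] at h0 ⊢
    rcases h0 with h0 | h0 <;> simpa [h0] using h3
  obtain ⟨c, hc⟩ := hdvd
  refine ⟨g1.divX, χ * C c + h1, ?_⟩
  have := divX_mul_X_add g1
  rw [hc] at this
  nth_rw 1 [← this]
  simp only [C_mul, map_natCast]
  ring

end Polynomial

/-! ### The adjugate of the characteristic matrix. -/

namespace Matrix

variable {ι R : Type*} [Fintype ι] [DecidableEq ι] [CommRing R]

lemma det_add_vecMulVec_of_isRegular {N : Matrix ι ι R} (hN : IsRegular N.det) (x y : ι → R) :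
    (N + vecMulVec x y).det = N.det + y ⬝ᵥ N.adjugate *ᵥ x := by
  let B : Matrix ι Unit R := replicateCol Unit x
  let D : Matrix Unit ι R := replicateRow Unit y
  have h1 : fromBlocks N B (-D) 1 * fromBlocks 1 (-(N.adjugate * B)) 0 (N.det • 1) =
      fromBlocks N 0 (-D) (D * N.adjugate * B + N.det • 1) := by
    rw [fromBlocks_multiply]
    congr 1
    · simp
    · rw [Matrix.mul_neg, ← Matrix.mul_assoc, mul_adjugate]
      simp
    · simp
    · simp [Matrix.mul_assoc]
  have h2 := congrArg det h1
  rw [det_mul, det_fromBlocks_one₂₂, det_fromBlocks_zero₂₁, det_fromBlocks_zero₁₂] at h2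
  have h3 : N - B * -D = N + vecMulVec x y := by
    ext i j
    simp [B, D, mul_apply, vecMulVec_apply]
  have h4 : (D * N.adjugate * B + N.det • 1).det = y ⬝ᵥ N.adjugate *ᵥ x + N.det := by
    rw [det_unique]
    simp only [add_apply, smul_apply, one_apply_eq, smul_eq_mul, mul_one, Matrix.mul_assoc]
    rfl
  rw [h3, h4] at h2
  have h5 : (N.det • (1 : Matrix Unit Unit R)).det = N.det := by simp
  rw [h5, det_one, one_mul, mul_comm] at h2
  rw [hN.left h2, add_comm]

/-- **Matrix determinant lemma** for a matrix that need not be invertible. -/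
theorem det_add_vecMulVec (N : Matrix ι ι R) (x y : ι → R) :
    (N + vecMulVec x y).det = N.det + y ⬝ᵥ N.adjugate *ᵥ x := by
  -- `N` is the value at `X = 0` of `XI + N`, whose determinant is monic and hence regular.
  let φ : R[X] →+* R := evalRingHom 0
  have hN : (charmatrix (-N)).map φ = N := by
    ext i j
    by_cases hij : i = j <;> simp [φ, hij]
  have h := det_add_vecMulVec_of_isRegular (N := charmatrix (-N))
    ((-N).charpoly_monic.isRegular) (C ∘ x) (C ∘ y)
  have h2 := congrArg φ h
  rw [map_add φ, RingHom.map_det, RingHom.map_det, RingHom.mapMatrix_apply,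
    RingHom.mapMatrix_apply, hN] at h2
  have h3 : (charmatrix (-N) + vecMulVec (C ∘ x) (C ∘ y)).map φ = N + vecMulVec x y := by
    rw [Matrix.map_add _ (map_add φ), hN]
    congr 1
    ext i j
    simp [φ, vecMulVec_apply]
  have h4 : φ ((C ∘ y) ⬝ᵥ (charmatrix (-N)).adjugate *ᵥ (C ∘ x)) = y ⬝ᵥ N.adjugate *ᵥ x := by
    rw [RingHom.map_dotProduct]
    have : φ ∘ ((charmatrix (-N)).adjugate *ᵥ (C ∘ x)) = N.adjugate *ᵥ x := by
      ext i
      have e := RingHom.map_adjugate φ (charmatrix (-N))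
      rw [RingHom.mapMatrix_apply, RingHom.mapMatrix_apply, hN] at e
      rw [Function.comp_apply, RingHom.map_mulVec, e]
      congr 1
      ext j
      simp [φ]
    rw [this]
    congr 1
    ext j
    simp [φ]
  rw [h3, h4] at h2
  exact h2

/-- The two by two minors of the adjugate are divisible by the determinant. -/
theorem det_dvd_adjugate_minor {N : Matrix ι ι R} (hN : IsRegular N.det) (hs : N.IsSymm)
    (x y : ι → R) :
    N.det ∣ (x ⬝ᵥ N.adjugate *ᵥ y) ^ 2 -
      (x ⬝ᵥ N.adjugate *ᵥ x) * (y ⬝ᵥ N.adjugate *ᵥ y) := by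
  let B : Matrix ι (Fin 2) R := of fun i k => ![x, y] k i
  -- Taking determinants gives `det N` times the bordered determinant as the 2×2 determinant of `-Bᵀ
  -- adj(N) B`, after one factor `det N` is cancelled.
  have h1 : fromBlocks N B Bᵀ 0 * fromBlocks 1 (-(N.adjugate * B)) 0 (N.det • 1) =
      fromBlocks N 0 Bᵀ (-(Bᵀ * N.adjugate * B)) := by
    rw [fromBlocks_multiply]
    congr 1
    · simp
    · rw [Matrix.mul_neg, ← Matrix.mul_assoc, mul_adjugate]
      simp
    · simp
    · simp [Matrix.mul_assoc]
  have h2 := congrArg det h1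
  rw [det_mul, det_fromBlocks_zero₂₁, det_fromBlocks_zero₁₂, det_one, one_mul, det_smul, det_one,
    mul_one, Fintype.card_fin, sq, mul_comm, mul_assoc] at h2
  have h3 := hN.left h2
  have hsym : y ⬝ᵥ N.adjugate *ᵥ x = x ⬝ᵥ N.adjugate *ᵥ y := by
    rw [dotProduct_mulVec, ← mulVec_transpose, adjugate_transpose, hs.eq, dotProduct_comm]
  have hE : ∀ a b : Fin 2, (Bᵀ * N.adjugate * B) a b = ![x, y] a ⬝ᵥ N.adjugate *ᵥ ![x, y] b := by
    intro a b
    rw [Matrix.mul_assoc]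
    rfl
  rw [det_fin_two] at h3
  simp only [neg_apply, hE] at h3
  simp only [cons_val_zero, cons_val_one, hsym] at h3
  exact ⟨-(fromBlocks N B Bᵀ 0).det, by linear_combination h3⟩

/-- The matrix coefficients of the adjugate of the characteristic matrix. -/
noncomputable def adjugateCoeff (A : Matrix ι ι R) (k : ℕ) : Matrix ι ι R :=
  of fun i j => ((charmatrix A).adjugate i j).coeff k

lemma coeff_dotProduct_adjugate_charmatrix (A : Matrix ι ι R) (x y : ι → R) (k : ℕ) :
    ((C ∘ x) ⬝ᵥ (charmatrix A).adjugate *ᵥ (C ∘ y)).coeff k = x ⬝ᵥ A.adjugateCoeff k *ᵥ y := by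
  simp [dotProduct, mulVec, adjugateCoeff]

lemma X_mul_adjugate_charmatrix (A : Matrix ι ι R) (i j : ι) :
    X * (charmatrix A).adjugate i j - ∑ l, C (A i l) * (charmatrix A).adjugate l j =
      if i = j then A.charpoly else 0 := by
  have h := congrFun₂ (mul_adjugate (charmatrix A)) i j
  rw [charmatrix, Matrix.sub_mul, ← charmatrix] at h
  simp only [sub_apply, scalar_apply, diagonal_mul, smul_apply, one_apply, smul_eq_mul] at h
  rw [mul_apply] at h
  simpa [charpoly] using h

/-- Coefficients of `(XI - A) adj(XI - A) = χ I`; read downwards, the recursion makes every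
coefficient matrix a polynomial in `A`. -/
lemma adjugateCoeff_succ (A : Matrix ι ι R) (k : ℕ) :
    A.adjugateCoeff k = A * A.adjugateCoeff (k + 1) + A.charpoly.coeff (k + 1) • 1 := by
  ext i j
  have h := congrArg (fun f => f.coeff (k + 1)) (X_mul_adjugate_charmatrix A i j)
  simp only [coeff_sub, coeff_X_mul, finsetSum_coeff, coeff_C_mul] at h
  rw [sub_eq_iff_eq_add'] at h
  simp only [adjugateCoeff, of_apply, add_apply, mul_apply, h, smul_apply, one_apply]
  congr 1
  split_ifs <;> simp

lemma mul_adjugateCoeff_zero (A : Matrix ι ι R) :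
    A * A.adjugateCoeff 0 = -(A.charpoly.coeff 0 • 1) := by
  ext i j
  have h := congrArg (fun f => f.coeff 0) (X_mul_adjugate_charmatrix A i j)
  simp only [coeff_sub, mul_coeff_zero, coeff_X_zero, zero_mul, finsetSum_coeff, coeff_C_zero,
    zero_sub] at h
  simp only [adjugateCoeff, of_apply, mul_apply, neg_apply, smul_apply, one_apply]
  rw [← neg_eq_iff_eq_neg, h]
  split_ifs <;> simp

lemma adjugateCoeff_eq_zero (A : Matrix ι ι R) {k : ℕ} (hk : Fintype.card ι ≤ k) :
    A.adjugateCoeff k = 0 := by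
  nontriviality R
  -- From index `n` on the recursion is homogeneous, so nonvanishing there would propagate to
  -- arbitrarily high coefficients.
  have hstep : ∀ j k, Fintype.card ι ≤ k → A.adjugateCoeff k = A ^ j * A.adjugateCoeff (k + j) := by
    intro j
    induction j with
    | zero => simp
    | succ j ih =>
      intro k hk
      rw [adjugateCoeff_succ, coeff_eq_zero_of_natDegree_lt
        (by rw [charpoly_natDegree_eq_dim]; omega), zero_smul, add_zero, ih (k + 1) (by omega),
        pow_succ', Matrix.mul_assoc, show k + 1 + j = k + (j + 1) by ring]
  obtain ⟨d, hd⟩ : ∃ d, ∀ i j, ((charmatrix A).adjugate i j).natDegree ≤ d := by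
    obtain ⟨d, hd⟩ := (Set.finite_range
      fun x : ι × ι => ((charmatrix A).adjugate x.1 x.2).natDegree).bddAbove
    exact ⟨d, fun i j => hd ⟨(i, j), rfl⟩⟩
  rw [hstep (d + 1) k hk]
  suffices h : A.adjugateCoeff (k + (d + 1)) = 0 by rw [h, Matrix.mul_zero]
  ext i j
  have := hd i j
  rw [adjugateCoeff, of_apply, coeff_eq_zero_of_natDegree_lt (by omega), zero_apply]

lemma adjugateCoeff_eq_one (A : Matrix ι ι R) {k : ℕ} (hk : Fintype.card ι = k + 1) :
    A.adjugateCoeff k = 1 := by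
  nontriviality R
  have : A.charpoly.coeff (k + 1) = 1 := by
    rw [← hk, ← A.charpoly_natDegree_eq_dim]
    exact A.charpoly_monic
  rw [adjugateCoeff_succ, adjugateCoeff_eq_zero A hk.le, this]
  simp

lemma adjugateCoeff_mem_range_aeval (A : Matrix ι ι R) (k : ℕ) :
    ∃ g : R[X], A.adjugateCoeff k = aeval A g := by
  have : ∀ j k, Fintype.card ι ≤ k + j → ∃ g : R[X], A.adjugateCoeff k = aeval A g := by
    intro j
    induction j with
    | zero => exact fun k hk => ⟨0, by rw [adjugateCoeff_eq_zero A (by omega), map_zero]⟩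
    | succ j ih =>
      intro k hk
      obtain ⟨g, hg⟩ := ih (k + 1) (by omega)
      refine ⟨X * g + C (A.charpoly.coeff (k + 1)), ?_⟩
      rw [adjugateCoeff_succ, hg]
      simp [Algebra.algebraMap_eq_smul_one]
  exact this (Fintype.card ι) k (by omega)

/-- An integer vector is divisible by `q` if its quadratic forms `v ⬝ A ^ k v` are divisible by
`q ^ 2`, provided that squares detect divisibility by `q` modulo the characteristic polynomial. -/
theorem dvd_of_sq_dvd_dotProduct_pow {A : Matrix ι ι ℤ} (hA : A.IsSymm) {q : ℕ}
    (hq : q.Prime) (hχ : A.charpoly.SqDetects q) {x : ι → ℤ}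
    (hx : ∀ k : ℕ, (q : ℤ) ^ 2 ∣ x ⬝ᵥ (A ^ k) *ᵥ x) (i : ι) : (q : ℤ) ∣ x i := by
  have : Fact q.Prime := ⟨hq⟩
  let F (y z : ι → ℤ) : ℤ[X] := (C ∘ y) ⬝ᵥ (charmatrix A).adjugate *ᵥ (C ∘ z)
  have hpoly : ∀ g : ℤ[X], (q : ℤ) ^ 2 ∣ x ⬝ᵥ (aeval A g) *ᵥ x := by
    intro g
    rw [aeval_eq_sum_range, sum_mulVec, dotProduct_sum]
    refine Finset.dvd_sum fun k _ => ?_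
    rw [smul_mulVec, dotProduct_smul]
    exact (hx k).mul_left _
  have hxx : (q : ℤ[X]) ^ 2 ∣ F x x := by
    rw [show (q : ℤ[X]) ^ 2 = C ((q : ℤ) ^ 2) by simp, C_dvd_iff_dvd_coeff]
    intro k
    rw [coeff_dotProduct_adjugate_charmatrix]
    obtain ⟨g, hg⟩ := A.adjugateCoeff_mem_range_aeval k
    rw [hg]
    exact hpoly g
  have hsymm : (charmatrix A).IsSymm := by
    rw [IsSymm, ← charmatrix_transpose, hA.eq]
  -- Modulo `χ`, `F(x, eᵢ)²` equals `F(x, x) F(eᵢ, eᵢ)`, which is divisible by `q²`.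
  obtain ⟨g, hg⟩ := det_dvd_adjugate_minor (N := charmatrix A) A.charpoly_monic.isRegular hsymm
    (C ∘ x) (C ∘ Pi.single i 1)
  obtain ⟨h, hh⟩ := hxx
  obtain ⟨g', h', hF⟩ := hχ (F x (Pi.single i 1)) g (h * F (Pi.single i 1) (Pi.single i 1)) (by
    have e1 : F x x = _ := hh
    change F x (Pi.single i 1) ^ 2 - F x x * F (Pi.single i 1) (Pi.single i 1) =
      A.charpoly * g at hg
    rw [e1] at hg
    linear_combination hg)
  obtain ⟨k, hk⟩ : ∃ k, Fintype.card ι = k + 1 :=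
    Nat.exists_eq_succ_of_ne_zero (Fintype.card_pos_iff.mpr ⟨i⟩).ne'
  have htop : (F x (Pi.single i 1)).coeff k = x i := by
    rw [coeff_dotProduct_adjugate_charmatrix, adjugateCoeff_eq_one A hk]
    rw [one_mulVec, dotProduct_single_one]
  -- `F(x, eᵢ)` has degree below `n`, so being a multiple of `χ` modulo `q` forces it to vanish
  -- modulo `q`. Its coefficient in degree `n - 1` is `x i`.
  have hmap : (F x (Pi.single i 1)).map (Int.castRingHom (ZMod q)) = 0 := by
    have hmon := A.charpoly_monic.map (Int.castRingHom (ZMod q))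
    refine eq_zero_of_dvd_of_degree_lt (p := A.charpoly.map (Int.castRingHom (ZMod q)))
      ⟨g'.map (Int.castRingHom (ZMod q)), by rw [hF]; simp⟩ ?_
    rw [A.charpoly_monic.degree_map, charpoly_degree_eq_dim]
    refine lt_of_le_of_lt degree_map_le ((degree_lt_iff_coeff_zero _ _).mpr fun m hm => ?_)
    rw [coeff_dotProduct_adjugate_charmatrix, adjugateCoeff_eq_zero A hm]
    rw [zero_mulVec, dotProduct_zero]
  rw [← natCast_dvd_iff_map_eq_zero, show (q : ℤ[X]) = C (q : ℤ) by simp, C_dvd_iff_dvd_coeff]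
    at hmap
  exact htop ▸ hmap k

end Matrix

/-! ### Walk counts and the rational orthogonal matrix. -/

namespace Matrix

variable {ι : Type*} [Fintype ι] [DecidableEq ι]

/-- Substituting `-1 - X` turns the characteristic matrix of `J - I - A` into `-(XI - A + J)`, a
rank-one update. -/
lemma charpoly_compl_comp (A : Matrix ι ι ℤ) :
    ((of fun _ _ => 1) - 1 - A : Matrix ι ι ℤ).charpoly.comp (-1 - X) =
      (-1) ^ Fintype.card ι *
        (A.charpoly + (C ∘ (1 : ι → ℤ)) ⬝ᵥ (charmatrix A).adjugate *ᵥ (C ∘ (1 : ι → ℤ))) := by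
  rw [charpoly, ← coe_compRingHom_apply, RingHom.map_det, charpoly, ← det_add_vecMulVec,
    ← det_neg]
  congr 1
  ext1 i j
  by_cases hij : i = j
  · subst hij
    simp
    ring
  · simp [hij]
    ring

/-- Generalized cospectral matrices have the same numbers of walks. -/
theorem dotProduct_pow_eq_of_cospectral {A A' : Matrix ι ι ℤ} (h1 : A.charpoly = A'.charpoly)
    (h2 : ((of fun _ _ => 1) - 1 - A : Matrix ι ι ℤ).charpoly =
      ((of fun _ _ => 1) - 1 - A' : Matrix ι ι ℤ).charpoly) (k : ℕ) :
    (1 : ι → ℤ) ⬝ᵥ (A ^ k) *ᵥ 1 = (1 : ι → ℤ) ⬝ᵥ (A' ^ k) *ᵥ 1 := by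
  rcases isEmpty_or_nonempty ι with hι | hι
  · simp [dotProduct]
  obtain ⟨m, hm⟩ : ∃ m, Fintype.card ι = m + 1 :=
    Nat.exists_eq_succ_of_ne_zero Fintype.card_pos.ne'
  have hF := congrArg (fun f => f.comp (-1 - X)) h2
  simp only [charpoly_compl_comp] at hF
  have hF' := (isUnit_one.neg.pow (Fintype.card ι)).mul_left_cancel hF
  rw [h1, add_right_inj] at hF'
  have hΦ : ∀ l, (1 : ι → ℤ) ⬝ᵥ A.adjugateCoeff l *ᵥ 1 = 1 ⬝ᵥ A'.adjugateCoeff l *ᵥ 1 := by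
    intro l
    rw [← coeff_dotProduct_adjugate_charmatrix, ← coeff_dotProduct_adjugate_charmatrix, hF']
  -- The induction runs over all `l` at once; the top coefficient matrix, `l = m`, is the identity
  -- and gives the walk count itself.
  have key : ∀ j l, (1 : ι → ℤ) ⬝ᵥ (A ^ j * A.adjugateCoeff l) *ᵥ 1 =
      1 ⬝ᵥ (A' ^ j * A'.adjugateCoeff l) *ᵥ 1 := by
    intro j
    induction j with
    | zero => simpa using hΦ
    | succ j ih =>
      have hj := ih m
      rw [adjugateCoeff_eq_one A hm, adjugateCoeff_eq_one A' hm, mul_one, mul_one] at hj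
      intro l
      cases l with
      | zero =>
        rw [pow_succ, pow_succ, Matrix.mul_assoc, Matrix.mul_assoc, mul_adjugateCoeff_zero,
          mul_adjugateCoeff_zero, h1]
        simp only [Matrix.mul_neg, Matrix.mul_smul, Matrix.mul_one, neg_mulVec, smul_mulVec,
          dotProduct_neg, dotProduct_smul, hj]
      | succ l =>
        have e := ih l
        rw [adjugateCoeff_succ A l, adjugateCoeff_succ A' l, h1] at e
        simp only [Matrix.mul_add, ← Matrix.mul_assoc, ← pow_succ, Matrix.mul_smul, Matrix.mul_one,
          add_mulVec, smul_mulVec, dotProduct_add, dotProduct_smul, hj] at e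
        exact add_right_cancel e
  have := key k m
  rwa [adjugateCoeff_eq_one A hm, adjugateCoeff_eq_one A' hm, mul_one, mul_one] at this

lemma mul_eq_mul_of_mulVec_eq_zero {ι : Type*} [Fintype ι] {N : Matrix ι ι ℚ} (hN : Fintype.card ι ≤ N.rank + 1)
    {x y : ι → ℚ} (hx : N *ᵥ x = 0) (hy : N *ᵥ y = 0) (k l : ι) : x k * y l = x l * y k := by
  have h1 := LinearMap.finrank_range_add_finrank_ker N.mulVecLin
  rw [Module.finrank_fintype_fun_eq_card] at h1
  have h2 : Module.finrank ℚ (LinearMap.ker N.mulVecLin) ≤ 1 := by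
    rw [rank] at hN
    omega
  obtain ⟨w, hw⟩ := finrank_le_one_iff.mp h2
  obtain ⟨a, ha⟩ := hw ⟨x, by simpa using hx⟩
  obtain ⟨b, hb⟩ := hw ⟨y, by simpa using hy⟩
  have ha' : a • (w : ι → ℚ) = x := congrArg Subtype.val ha
  have hb' : b • (w : ι → ℚ) = y := congrArg Subtype.val hb
  rw [← ha', ← hb']
  simp only [Pi.smul_apply, smul_eq_mul]
  ring

lemma eq_zero_of_mul_transpose_self_eq_zero {m n : Type*} [Fintype n] {Z : Matrix m n ℚ}
    (h : Z * Zᵀ = 0) : Z = 0 := by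
  rw [← conjTranspose_eq_transpose_of_trivial] at h
  exact self_mul_conjTranspose_eq_zero.mp h

/-- A null vector `z` is killed by `Wᵀ` and by `adj W`. With `x` spanning `ker W`, `W + zxᵀ` is then
singular; its null vector is orthogonal to `x` yet lies in `ker W`, a contradiction. -/
lemma det_mul_transpose_add_adjugate_ne_zero {W : Matrix ι ι ℚ}
    (hrank : Fintype.card ι ≤ W.rank + 1) (hdet : W.det = 0) :
    (W * Wᵀ + W.adjugateᵀ * W.adjugate).det ≠ 0 := by
  intro h0
  obtain ⟨z, hz0, hz⟩ := exists_mulVec_eq_zero_iff.mpr h0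
  obtain ⟨x, hx0, hx⟩ := exists_mulVec_eq_zero_iff.mpr hdet
  have hsum : (Wᵀ *ᵥ z) ⬝ᵥ (Wᵀ *ᵥ z) + (W.adjugate *ᵥ z) ⬝ᵥ (W.adjugate *ᵥ z) = 0 := by
    have := congrArg (fun y => z ⬝ᵥ y) hz
    simp only [add_mulVec, dotProduct_add, dotProduct_zero, ← mulVec_mulVec] at this
    rw [dotProduct_mulVec z W, ← mulVec_transpose, dotProduct_mulVec z W.adjugateᵀ,
      ← mulVec_transpose, transpose_transpose] at this
    exact this
  have hnn : ∀ y : ι → ℚ, 0 ≤ y ⬝ᵥ y := fun y => Finset.sum_nonneg fun i _ => mul_self_nonneg _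
  have hWz : Wᵀ *ᵥ z = 0 := dotProduct_self_eq_zero.mp
    (by linarith [hnn (Wᵀ *ᵥ z), hnn (W.adjugate *ᵥ z)])
  have hVz : W.adjugate *ᵥ z = 0 := dotProduct_self_eq_zero.mp
    (by linarith [hnn (Wᵀ *ᵥ z), hnn (W.adjugate *ᵥ z)])
  have hd : (W + vecMulVec z x).det = 0 := by
    rw [det_add_vecMulVec, hdet, hVz, dotProduct_zero, add_zero]
  obtain ⟨w, hw0, hw⟩ := exists_mulVec_eq_zero_iff.mpr hd
  have hvec : vecMulVec z x *ᵥ w = (x ⬝ᵥ w) • z := by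
    rw [vecMulVec_mulVec]
    ext i
    simp [mul_comm]
  rw [add_mulVec, hvec] at hw
  have hxw : x ⬝ᵥ w = 0 := by
    have := congrArg (fun y => z ⬝ᵥ y) hw
    simp only [dotProduct_add, dotProduct_zero, dotProduct_smul, smul_eq_mul] at this
    rw [dotProduct_mulVec, ← mulVec_transpose, hWz, zero_dotProduct, zero_add] at this
    exact (mul_eq_zero.mp this).resolve_right fun h => hz0 (dotProduct_self_eq_zero.mp h)
  rw [hxw, zero_smul, add_zero] at hw
  apply hw0
  ext l
  have h1 : (x ⬝ᵥ x) * w l = x l * (x ⬝ᵥ w) := by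
    simp only [dotProduct, Finset.sum_mul, Finset.mul_sum]
    refine Finset.sum_congr rfl fun k _ => ?_
    rw [mul_assoc, mul_eq_mul_of_mulVec_eq_zero hrank hx hw k l]
    ring
  rw [hxw, mul_zero] at h1
  exact (mul_eq_zero.mp h1).resolve_left fun h => hx0 (dotProduct_self_eq_zero.mp h)

/-- Two rational matrices of corank at most one with the same Gram matrix differ by a rational
orthogonal matrix. -/
theorem exists_orthogonal_mul_eq {W W' : Matrix ι ι ℚ} (hgram : Wᵀ * W = W'ᵀ * W')
    (hrank : Fintype.card ι ≤ W.rank + 1) : ∃ Q : Matrix ι ι ℚ, Qᵀ * Q = 1 ∧ Q * W = W' := by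
  have hsq : W.det * W.det = W'.det * W'.det := by
    have := congrArg det hgram
    rwa [det_mul, det_mul, det_transpose, det_transpose] at this
  by_cases hdet : W.det = 0
  · have hdet' : W'.det = 0 := by
      rw [hdet, zero_mul] at hsq
      exact mul_self_eq_zero.mp hsq.symm
    -- The rows of `adj W` are orthogonal to the columns of `W` and supply the missing direction,
    -- and `VVᵀ = adj(WᵀW)` depends only on the Gram matrix. A map with `W ↦ W'` and `Vᵀ ↦ V'ᵀ` must
    -- send `P` to `T`, whence `Q = TP⁻¹`.
    set V := W.adjugate with hV
    set V' := W'.adjugate with hV'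
    have hVW : V * W = 0 := by rw [hV, adjugate_mul, hdet, zero_smul]
    have hVW' : V' * W' = 0 := by rw [hV', adjugate_mul, hdet', zero_smul]
    have hWV' : W'ᵀ * V'ᵀ = 0 := by rw [← transpose_mul, hVW', transpose_zero]
    have hWV : Wᵀ * Vᵀ = 0 := by rw [← transpose_mul, hVW, transpose_zero]
    have hVV : V * Vᵀ = V' * V'ᵀ := by
      rw [hV, hV', adjugate_transpose, adjugate_transpose, ← adjugate_mul_distrib,
        ← adjugate_mul_distrib, hgram]
    set P := W * Wᵀ + Vᵀ * V with hP
    set T := W' * Wᵀ + V'ᵀ * V with hT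
    have hPdet : IsUnit P.det :=
      isUnit_iff_ne_zero.mpr (det_mul_transpose_add_adjugate_ne_zero hrank hdet)
    have hPsymm : Pᵀ = P := by simp [hP]
    have hPW : P * W = W * (Wᵀ * W) := by
      rw [hP, Matrix.add_mul, Matrix.mul_assoc Vᵀ, hVW, Matrix.mul_zero, add_zero,
        Matrix.mul_assoc]
    have hTW : T * W = W' * (Wᵀ * W) := by
      rw [hT, Matrix.add_mul, Matrix.mul_assoc V'ᵀ, hVW, Matrix.mul_zero, add_zero,
        Matrix.mul_assoc]
    have hTT : Tᵀ * T = P * P := by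
      have e1 : Tᵀ * T = W * (W'ᵀ * W') * Wᵀ + Vᵀ * (V' * V'ᵀ) * V := by
        simp only [hT, transpose_add, transpose_mul, transpose_transpose, Matrix.add_mul,
          Matrix.mul_add, Matrix.mul_assoc]
        rw [← Matrix.mul_assoc W'ᵀ V'ᵀ, hWV', ← Matrix.mul_assoc V' W', hVW']
        simp
      have e2 : P * P = W * (Wᵀ * W) * Wᵀ + Vᵀ * (V * Vᵀ) * V := by
        simp only [hP, Matrix.add_mul, Matrix.mul_add, Matrix.mul_assoc]
        rw [← Matrix.mul_assoc Wᵀ Vᵀ, hWV, ← Matrix.mul_assoc V W, hVW]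
        simp
      rw [e1, e2, hgram, hVV]
    have hQQ : (T * P⁻¹)ᵀ * (T * P⁻¹) = 1 := by
      rw [transpose_mul, transpose_nonsing_inv, hPsymm, Matrix.mul_assoc, ← Matrix.mul_assoc Tᵀ,
        hTT, Matrix.mul_assoc, mul_nonsing_inv _ hPdet, Matrix.mul_one, nonsing_inv_mul _ hPdet]
    refine ⟨T * P⁻¹, hQQ, sub_eq_zero.mp ?_⟩
    set Z := T * P⁻¹ * W - W' with hZ
    have hZS : Z * (Wᵀ * W) = 0 := by
      rw [hZ, Matrix.sub_mul, ← hTW, Matrix.mul_assoc, ← hPW, Matrix.mul_assoc,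
        nonsing_inv_mul_cancel_left _ _ hPdet, sub_self]
    have hZ1 : Z * Wᵀ = 0 := by
      apply eq_zero_of_mul_transpose_self_eq_zero
      rw [transpose_mul, transpose_transpose, Matrix.mul_assoc, ← Matrix.mul_assoc Wᵀ,
        ← Matrix.mul_assoc, hZS, Matrix.zero_mul]
    have hZ2 : Z * W'ᵀ = 0 := by
      apply eq_zero_of_mul_transpose_self_eq_zero
      rw [transpose_mul, transpose_transpose, Matrix.mul_assoc, ← Matrix.mul_assoc W'ᵀ,
        ← Matrix.mul_assoc, ← hgram, hZS, Matrix.zero_mul]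
    apply eq_zero_of_mul_transpose_self_eq_zero
    nth_rw 2 [hZ]
    rw [transpose_sub, transpose_mul _ W, Matrix.mul_sub, ← Matrix.mul_assoc, hZ1, hZ2,
      Matrix.zero_mul, sub_zero]
  · have hu : IsUnit W.det := isUnit_iff_ne_zero.mpr hdet
    refine ⟨W' * W⁻¹, ?_, nonsing_inv_mul_cancel_right _ _ hu⟩
    rw [transpose_mul, Matrix.mul_assoc, ← Matrix.mul_assoc W'ᵀ, ← hgram, Matrix.mul_assoc,
      mul_nonsing_inv _ hu, Matrix.mul_one, ← transpose_mul, mul_nonsing_inv _ hu, transpose_one]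

/-- An orthogonal matrix that intertwines two symmetric matrices of the same trace on a subspace of
codimension at most one intertwines them. -/
theorem mul_eq_mul_of_orthogonal {A A' W W' Q : Matrix ι ι ℚ} (hA : A.IsSymm) (hA' : A'.IsSymm)
    (htr : A.trace = A'.trace) (hQ : Qᵀ * Q = 1) (hQW : Q * W = W')
    (hAW : Q * (A * W) = A' * W') (hrank : Fintype.card ι ≤ W'.rank + 1) : Q * A = A' * Q := by
  set E := Q * A * Qᵀ - A' with hE
  have hEsymm : Eᵀ = E := by
    simp [hE, hA.eq, hA'.eq, Matrix.mul_assoc]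
  have hEW : E * W' = 0 := by
    rw [hE, Matrix.sub_mul, ← hAW, Matrix.mul_assoc, ← hQW, ← Matrix.mul_assoc Qᵀ, hQ,
      Matrix.one_mul, Matrix.mul_assoc, sub_self]
  have hEtr : E.trace = 0 := by
    rw [hE, trace_sub, trace_mul_cycle, hQ, Matrix.one_mul, htr, sub_self]
  have hrow : ∀ i, W'ᵀ *ᵥ E i = 0 := by
    intro i
    ext j
    rw [mulVec_transpose]
    exact congrFun₂ hEW i j
  -- The rows of `E` lie in a space of dimension at most one, so its 2×2 minors vanish. Summing, `∑
  -- Eᵢⱼ² = (tr E)² = 0`.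
  have hminor : ∀ i j, E i j * E i j = E i i * E j j := by
    intro i j
    have h := mul_eq_mul_of_mulVec_eq_zero (N := W'ᵀ) (by rwa [rank_transpose]) (hrow i) (hrow j)
      j i
    have hs : E j i = E i j := congrFun₂ hEsymm i j
    rwa [hs] at h
  have hEE : ∑ i, ∑ j, E i j * E i j = 0 := by
    calc ∑ i, ∑ j, E i j * E i j = ∑ i, ∑ j, E i i * E j j :=
          Finset.sum_congr rfl fun i _ => Finset.sum_congr rfl fun j _ => hminor i j
      _ = E.trace * E.trace := (Finset.sum_mul_sum _ _ _ _).symm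
      _ = 0 := by rw [hEtr, zero_mul]
  have hE0 : E = 0 := by
    ext i j
    have h1 := (Finset.sum_eq_zero_iff_of_nonneg fun i _ =>
      Finset.sum_nonneg fun j _ => mul_self_nonneg (E i j)).mp hEE i (Finset.mem_univ i)
    have h2 := (Finset.sum_eq_zero_iff_of_nonneg fun j _ => mul_self_nonneg (E i j)).mp h1 j
      (Finset.mem_univ j)
    exact mul_self_eq_zero.mp h2
  have h1 : Q * A * Qᵀ = A' := sub_eq_zero.mp hE0
  rw [← h1, Matrix.mul_assoc, hQ, Matrix.mul_one]

end Matrix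

/-! ### Integrality of the orthogonal matrix, and permutations. -/

namespace Matrix

variable {ι : Type*} [Fintype ι] [DecidableEq ι]

lemma exists_smul_eq_intCast (m : ι → ℚ) : ∃ N : ℕ, 0 < N ∧ ∃ x : ι → ℤ, ∀ i, N * m i = x i := by
  refine ⟨∏ i, (m i).den, Finset.prod_pos fun i _ => (m i).den_pos, ?_⟩
  have : ∀ i, ∃ z : ℤ, ((∏ i, (m i).den : ℕ) : ℚ) * m i = z := by
    intro i
    refine ⟨(∏ j ∈ Finset.univ.erase i, (m j).den : ℕ) * (m i).num, ?_⟩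
    rw [← Finset.mul_prod_erase _ _ (Finset.mem_univ i)]
    push_cast
    have := Rat.mul_den_eq_num (m i)
    linear_combination (∏ j ∈ Finset.univ.erase i, ((m j).den : ℚ)) * this
  choose x hx using this
  exact ⟨x, hx⟩

/-- A rational vector with integral moments with respect to `A` is integral. -/
theorem exists_intCast_of_integral_moments {A : Matrix ι ι ℤ} (hA : A.IsSymm)
    (hχ : ∀ q : ℕ, q.Prime → A.charpoly.SqDetects q) {m : ι → ℚ}
    (hm : ∀ k : ℕ, ∃ z : ℤ, m ⬝ᵥ (A.map (Int.castRingHom ℚ) ^ k) *ᵥ m = z) :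
    ∃ x : ι → ℤ, ∀ i, m i = x i := by
  classical
  have hex := exists_smul_eq_intCast m
  obtain ⟨hpos, x, hx⟩ := Nat.find_spec hex
  by_cases h1 : Nat.find hex = 1
  · exact ⟨x, fun i => by rw [← hx i, h1]; simp⟩
  exfalso
  -- The moments of `x = Nm` are `N²` times integers, so `q²` divides them; dividing `x` by `q`
  -- contradicts the minimality of `N`.
  obtain ⟨q, hq, N', hN'⟩ := Nat.exists_prime_and_dvd h1
  have hxm : (fun i => (x i : ℚ)) = ((Nat.find hex : ℕ) : ℚ) • m := by
    ext i
    simp [hx i]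
  have hdvd := dvd_of_sq_dvd_dotProduct_pow hA hq (hχ q hq) (x := x) (fun k => by
    obtain ⟨z, hz⟩ := hm k
    refine ⟨N' ^ 2 * z, ?_⟩
    have e : ((x ⬝ᵥ (A ^ k) *ᵥ x : ℤ) : ℚ) =
        (fun i => (x i : ℚ)) ⬝ᵥ (A.map (Int.castRingHom ℚ) ^ k) *ᵥ fun i => (x i : ℚ) := by
      have : (A.map (Int.castRingHom ℚ)) ^ k = (A ^ k).map (Int.castRingHom ℚ) :=
        (map_pow (Int.castRingHom ℚ).mapMatrix A k).symm
      rw [this]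
      simp [dotProduct, mulVec]
    rw [hxm, mulVec_smul, smul_dotProduct, dotProduct_smul, hz, hN'] at e
    have e' : ((x ⬝ᵥ (A ^ k) *ᵥ x : ℤ) : ℚ) = ((q ^ 2 * (N' ^ 2 * z) : ℤ) : ℚ) := by
      rw [e]
      push_cast
      simp only [smul_eq_mul]
      ring
    exact_mod_cast e')
  choose y hy using hdvd
  have hN'pos : 0 < N' := Nat.pos_of_mul_pos_left (hN' ▸ hpos)
  refine Nat.find_min hex (m := N') ?_ ⟨hN'pos, y, fun i => ?_⟩
  · rw [hN']
    exact lt_mul_left hN'pos hq.one_lt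
  · have h2 := hx i
    rw [hN', hy i] at h2
    push_cast at h2
    have hq0 : (q : ℚ) ≠ 0 := by exact_mod_cast hq.ne_zero
    exact mul_left_cancel₀ hq0 (by linear_combination h2)

/-- An integer orthogonal matrix fixing the all-ones vector is a permutation matrix. -/
theorem exists_perm_of_orthogonal {Z : Matrix ι ι ℤ} (hZ : Z * Zᵀ = 1) (hone : Z *ᵥ 1 = 1) :
    ∃ σ : Equiv.Perm ι, ∀ i j, Z i j = if σ i = j then 1 else 0 := by
  have hsq : ∀ i, ∑ j, Z i j * Z i j = 1 := by
    intro i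
    have := congrFun₂ hZ i i
    rwa [one_apply_eq, mul_apply] at this
  have hsum : ∀ i, ∑ j, Z i j = 1 := by
    intro i
    have := congrFun hone i
    simpa [mulVec, dotProduct] using this
  -- Each row has sum 1 and square sum 1, so the nonnegative integers `z² - z` add up to 0.
  have h01 : ∀ i j, Z i j = 0 ∨ Z i j = 1 := by
    intro i j
    have h0 : ∑ j, (Z i j * Z i j - Z i j) = 0 := by
      rw [Finset.sum_sub_distrib, hsq, hsum, sub_self]
    have hnn : ∀ a : ℤ, 0 ≤ a * a - a := by
      intro a
      rcases le_or_gt a 0 with h | h <;> nlinarith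
    have h1 := (Finset.sum_eq_zero_iff_of_nonneg fun j _ => hnn (Z i j)).mp h0 j
      (Finset.mem_univ j)
    have h2 : Z i j * (Z i j - 1) = 0 := by linarith
    rcases mul_eq_zero.mp h2 with h | h
    · exact Or.inl h
    · exact Or.inr (by linarith)
  have hex : ∀ i, ∃ j, Z i j = 1 := by
    intro i
    by_contra! h
    have : ∑ j, Z i j = 0 := Finset.sum_eq_zero fun j _ => (h01 i j).resolve_right (h j)
    rw [hsum] at this
    exact one_ne_zero this
  choose σ hσ using hex
  have hval : ∀ i j, Z i j = if σ i = j then 1 else 0 := by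
    intro i j
    split_ifs with h
    · rw [← h, hσ]
    · have h1 := hsum i
      rw [← Finset.add_sum_erase _ _ (Finset.mem_univ (σ i)), hσ, add_eq_left] at h1
      exact (Finset.sum_eq_zero_iff_of_nonneg fun k _ => by
        rcases h01 i k with hk | hk <;> simp [hk]).mp h1 j (by simp [Ne.symm h])
  have hinj : Function.Injective σ := by
    intro i i' h
    by_contra hne
    have := congrFun₂ hZ i i'
    rw [one_apply_ne hne, mul_apply] at this
    simp [hval, h] at this
  exact ⟨Equiv.ofBijective σ (Finite.injective_iff_bijective.mp hinj), fun i j => hval i j⟩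

lemma mulVec_pow_eq_of_lt {R : Type*} [CommRing R] {A A' Q : Matrix ι ι R} {e : ι → R}
    (hχ : A.charpoly = A'.charpoly)
    (h : ∀ k < Fintype.card ι, Q *ᵥ (A ^ k *ᵥ e) = A' ^ k *ᵥ e) (k : ℕ) :
    Q *ᵥ (A ^ k *ᵥ e) = A' ^ k *ᵥ e := by
  nontriviality R
  rw [pow_eq_aeval_mod_charpoly A k, pow_eq_aeval_mod_charpoly A' k, hχ]
  set f := X ^ k %ₘ A'.charpoly with hf
  have hdeg : f.degree < Fintype.card ι := by
    simpa using degree_modByMonic_lt (X ^ k) A'.charpoly_monic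
  simp only [aeval_eq_sum_range, sum_mulVec, mulVec_sum, smul_mulVec, mulVec_smul]
  refine Finset.sum_congr rfl fun i _ => ?_
  by_cases hi : i < Fintype.card ι
  · rw [h i hi]
  · rw [coeff_eq_zero_of_degree_lt (hdeg.trans_le (by exact_mod_cast not_lt.mp hi)), zero_smul,
      zero_smul]

/-- Generalized cospectral symmetric integer matrices are conjugate by a permutation, provided that
the walk matrix has corank at most one and squares detect divisibility by every prime modulo the
characteristic polynomial. -/
theorem exists_perm_of_cospectral {A A' : Matrix ι ι ℤ} (hA : A.IsSymm) (hA' : A'.IsSymm)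
    (h1 : A.charpoly = A'.charpoly)
    (h2 : ((of fun _ _ => 1) - 1 - A : Matrix ι ι ℤ).charpoly =
      ((of fun _ _ => 1) - 1 - A' : Matrix ι ι ℤ).charpoly)
    (hχ : ∀ q : ℕ, q.Prime → A.charpoly.SqDetects q)
    (hrank : Fintype.card ι ≤ ((of fun i (k : Fin (Fintype.card ι)) =>
      (A ^ (k : ℕ) *ᵥ 1) i : Matrix ι (Fin (Fintype.card ι)) ℤ).map (Int.cast : ℤ → ℚ)).rank + 1) :
    ∃ σ : Equiv.Perm ι, ∀ i j, A (σ i) (σ j) = A' i j := by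
  let φ := (Int.castRingHom ℚ).mapMatrix (m := ι)
  let e := Fintype.equivFin ι
  let walk (B : Matrix ι ι ℤ) : Matrix ι ι ℚ := of fun i j => (φ B ^ (e j : ℕ) *ᵥ 1) i
  have hφ1 : ∀ (B : Matrix ι ι ℤ) (k : ℕ) i, (φ B ^ k *ᵥ 1) i = (((B ^ k *ᵥ 1) i : ℤ) : ℚ) := by
    intro B k i
    rw [← map_pow]
    simp [φ, mulVec, dotProduct]
  have hsymm : ∀ {B : Matrix ι ι ℤ}, B.IsSymm → (φ B).IsSymm := fun hB => by
    ext i j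
    simp [φ, hB.apply j i]
  have hgramB : ∀ {B : Matrix ι ι ℤ}, B.IsSymm → ∀ i j,
      ((walk B)ᵀ * walk B) i j = (((1 : ι → ℤ) ⬝ᵥ (B ^ (e i + e j : ℕ)) *ᵥ 1 : ℤ) : ℚ) := by
    intro B hB i j
    have hdot : ((walk B)ᵀ * walk B) i j =
        (φ B ^ (e i : ℕ) *ᵥ 1) ⬝ᵥ (φ B ^ (e j : ℕ) *ᵥ 1) := rfl
    rw [hdot, ← vecMul_transpose, transpose_pow, (hsymm hB).eq, ← dotProduct_mulVec,
      mulVec_mulVec, ← pow_add]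
    simp [dotProduct, hφ1]
  have hgram : (walk A)ᵀ * walk A = (walk A')ᵀ * walk A' := by
    ext i j
    rw [hgramB hA, hgramB hA', dotProduct_pow_eq_of_cospectral h1 h2]
  have hr : Fintype.card ι ≤ (walk A).rank + 1 := by
    have : walk A = ((of fun i (k : Fin (Fintype.card ι)) =>
      (A ^ (k : ℕ) *ᵥ 1) i : Matrix ι (Fin (Fintype.card ι)) ℤ).map
        (Int.cast : ℤ → ℚ)).submatrix (Equiv.refl ι) e := by
      ext i j
      simp only [walk, of_apply, hφ1, submatrix_apply, map_apply, Equiv.refl_apply]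
    rwa [this, rank_submatrix]
  have hr' : Fintype.card ι ≤ (walk A').rank + 1 := by
    rwa [← rank_transpose_mul_self, ← hgram, rank_transpose_mul_self]
  obtain ⟨Q, hQ, hQW⟩ := exists_orthogonal_mul_eq hgram hr
  have hχφ : (φ A).charpoly = (φ A').charpoly := by
    simp only [φ, RingHom.mapMatrix_apply, charpoly_map, h1]
  have hcol : ∀ k, Q *ᵥ (φ A ^ k *ᵥ 1) = φ A' ^ k *ᵥ 1 := by
    refine mulVec_pow_eq_of_lt hχφ fun k hk => ?_
    ext i
    have := congrFun₂ hQW i (e.symm ⟨k, hk⟩)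
    simpa [walk, mul_apply, mulVec, dotProduct] using this
  have hAW : Q * (φ A * walk A) = φ A' * walk A' := by
    ext i j
    have := congrFun (hcol (e j + 1)) i
    rw [pow_succ', pow_succ', ← mulVec_mulVec, ← mulVec_mulVec] at this
    exact this
  have htr : (φ A).trace = (φ A').trace := by
    rw [trace_eq_neg_charpoly_nextCoeff, trace_eq_neg_charpoly_nextCoeff, hχφ]
  have hQA := mul_eq_mul_of_orthogonal (hsymm hA) (hsymm hA') htr hQ hQW hAW hr'
  have hQ' : Q * Qᵀ = 1 := mul_eq_one_comm.mp hQ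
  have hpow : ∀ k, Q * φ A ^ k = φ A' ^ k * Q := by
    intro k
    induction k with
    | zero => simp
    | succ k ih => rw [pow_succ, ← Matrix.mul_assoc, ih, Matrix.mul_assoc, hQA, ← Matrix.mul_assoc,
        ← pow_succ]
  -- The moments of row `i` of `Q` are the diagonal entries `(A'ᵏ)ᵢᵢ`, because `Q Aᵏ Qᵀ = A'ᵏ`.
  have hint : ∀ i, ∃ x : ι → ℤ, ∀ j, Q i j = x j := by
    intro i
    refine exists_intCast_of_integral_moments hA hχ fun k => ⟨(A' ^ k) i i, ?_⟩
    have h3 : Q * φ A ^ k * Qᵀ = φ A' ^ k := by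
      rw [hpow, Matrix.mul_assoc, hQ', Matrix.mul_one]
    have h4 := congrFun₂ h3 i i
    rw [← map_pow φ A', Matrix.mul_assoc] at h4
    exact h4
  choose Z hZ using hint
  have hQZ : Q = φ (of Z) := by
    ext i j
    simp [φ, hZ]
  have hinj : Function.Injective φ := map_injective Int.cast_injective
  have hZZ : of Z * (of Z)ᵀ = 1 := by
    apply hinj
    rw [map_mul, map_one, ← hQ', hQZ]
    rfl
  have hZ1 : of Z *ᵥ 1 = 1 := by
    have := hcol 0
    rw [pow_zero, pow_zero, one_mulVec] at this
    ext i
    have h5 := congrFun this i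
    rw [hQZ] at h5
    have h6 := hφ1 (of Z) 1 i
    rw [pow_one, pow_one, h5, Pi.one_apply] at h6
    rw [Pi.one_apply]
    exact_mod_cast h6.symm
  have hZA : of Z * A = A' * of Z := by
    apply hinj
    rw [map_mul, map_mul, ← hQZ, hQA]
  obtain ⟨σ, hσ⟩ := exists_perm_of_orthogonal hZZ hZ1
  refine ⟨σ, fun i j => ?_⟩
  have h7 := congrFun₂ hZA i (σ j)
  simpa [mul_apply, hσ] using h7

end Matrix

/-! ### Discriminants of `p(x²)` and `x p(x²)`. -/

namespace Polynomial

lemma roots_expand_two {K : Type*} [Field K] {P : K[X]} (hP : P.Monic) (hs : P.Splits)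
    {s : K → K} (hsq : ∀ z, s z ^ 2 = z) :
    (expand K 2 P).roots = P.roots.map s + P.roots.map fun z => -s z := by
  have h : expand K 2 P = ((P.roots.map s + P.roots.map fun z => -s z).map (X - C ·)).prod := by
    conv_lhs => rw [hs.eq_prod_roots_of_monic hP]
    rw [map_multiset_prod, Multiset.map_map, Multiset.map_add, Multiset.prod_add, Multiset.map_map,
      Multiset.map_map, ← Multiset.prod_map_mul]
    congr 1
    refine Multiset.map_congr rfl fun z _ => ?_
    simp only [Function.comp_apply, map_sub, expand_X, expand_C, C_neg]
    nth_rw 1 [← hsq z]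
    rw [C_pow]
    ring
  rw [h, roots_multiset_prod_X_sub_C]

lemma prod_roots_sq {K : Type*} [Field K] {P : K[X]} (hP : P.Monic) (hs : P.Splits)
    (h0 : P.coeff 0 ^ 2 = 1) : P.roots.prod ^ 2 = 1 := by
  rw [hs.coeff_zero_eq_prod_roots_of_monic hP, mul_pow, ← pow_mul, mul_comm _ 2, pow_mul] at h0
  simpa using h0

/-- At `±√z` the derivative `2x P'(x²)` takes values with product `-4z P'(z)²`, and the product of
all `z` is `±1`. Squaring discards the signs. -/
lemma discr_expand_two_sq {K : Type*} [Field K] [IsAlgClosed K] {P : K[X]} (hP : P.Monic)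
    (h0 : P.coeff 0 ^ 2 = 1) :
    (expand K 2 P).discr ^ 2 = (4 ^ P.natDegree * P.discr ^ 2) ^ 2 := by
  have hs := IsAlgClosed.splits P
  choose s hsq using fun z : K => IsAlgClosed.exists_pow_nat_eq z two_pos
  rw [(hP.expand two_pos).discr_sq_eq (IsAlgClosed.splits _), roots_expand_two hP hs hsq,
    hP.discr_sq_eq hs, Multiset.map_add, Multiset.prod_add, Multiset.map_map, Multiset.map_map,
    ← Multiset.prod_map_mul, hs.natDegree_eq_card_roots]
  have hval : (P.roots.map fun z => ((expand K 2 P).derivative.eval ∘ s) z *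
      ((expand K 2 P).derivative.eval ∘ fun z => -s z) z) =
      P.roots.map fun z => (-4) * z * (P.derivative.eval z ^ 2) := by
    refine Multiset.map_congr rfl fun z _ => ?_
    simp only [Function.comp_apply, derivative_expand, eval_mul, expand_eval, hsq, neg_sq,
      eval_natCast, eval_pow, eval_X]
    push_cast
    linear_combination (-4) * (P.derivative.eval z ^ 2) * hsq z
  have h4 : ((-4 : K) ^ P.roots.card) ^ 2 = (4 ^ P.roots.card) ^ 2 := by
    rw [← pow_mul, mul_comm, pow_mul, neg_sq, ← pow_mul, mul_comm, pow_mul]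
  rw [hval, Multiset.prod_map_mul, Multiset.prod_map_mul, Multiset.map_const',
    Multiset.prod_replicate, Multiset.prod_map_pow, Multiset.map_id', mul_pow, mul_pow,
    prod_roots_sq hP hs h0, h4]
  ring

/-- Each pair `±√z` now contributes `4z² P'(z)²`, and the root 0 contributes `P(0) = ±1`. -/
lemma discr_X_mul_expand_two_sq {K : Type*} [Field K] [IsAlgClosed K] {P : K[X]} (hP : P.Monic)
    (h0 : P.coeff 0 ^ 2 = 1) :
    (X * expand K 2 P).discr ^ 2 = (4 ^ P.natDegree * P.discr ^ 2) ^ 2 := by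
  have hs := IsAlgClosed.splits P
  choose s hsq using fun z : K => IsAlgClosed.exists_pow_nat_eq z two_pos
  have hE := hP.expand two_pos
  have hroots : (X * expand K 2 P).roots =
      {0} + (P.roots.map s + P.roots.map fun z => -s z) := by
    rw [roots_mul (mul_ne_zero X_ne_zero hE.ne_zero), roots_X, roots_expand_two hP hs hsq]
  rw [(monic_X.mul hE).discr_sq_eq (IsAlgClosed.splits _), hroots,
    hP.discr_sq_eq hs, Multiset.map_add, Multiset.map_add, Multiset.prod_add, Multiset.prod_add,
    Multiset.map_map, Multiset.map_map, ← Multiset.prod_map_mul, hs.natDegree_eq_card_roots]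
  have hval : (P.roots.map fun z => ((X * expand K 2 P).derivative.eval ∘ s) z *
      ((X * expand K 2 P).derivative.eval ∘ fun z => -s z) z) =
      P.roots.map fun z => 4 * z ^ 2 * (P.derivative.eval z ^ 2) := by
    refine Multiset.map_congr rfl fun z hz => ?_
    have hz0 : P.eval z = 0 := isRoot_of_mem_roots hz
    simp only [Function.comp_apply, derivative_mul, derivative_X, one_mul, derivative_expand,
      eval_add, eval_mul, expand_eval, hsq, neg_sq, eval_natCast, eval_pow, eval_X, hz0, zero_add]
    push_cast
    linear_combination 4 * (P.derivative.eval z ^ 2) * (s z ^ 2 + z) * hsq z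
  have hzero : (Multiset.map (X * expand K 2 P).derivative.eval {0}).prod = P.coeff 0 := by
    simp [coeff_zero_eq_eval_zero, expand_eval]
  rw [hval, hzero, Multiset.prod_map_mul, Multiset.prod_map_mul, Multiset.map_const',
    Multiset.prod_replicate, Multiset.prod_map_pow, Multiset.prod_map_pow, Multiset.map_id',
    prod_roots_sq hP hs h0]
  rw [mul_pow, h0]
  ring

theorem discr_sq_of_eq_X_pow_mul_expand {p χ : ℤ[X]} (hp : p.Monic)
    (h0 : p.coeff 0 = 1 ∨ p.coeff 0 = -1) (hχ : χ = expand ℤ 2 p ∨ χ = X * expand ℤ 2 p) :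
    χ.discr ^ 2 = (4 ^ p.natDegree * p.discr ^ 2) ^ 2 := by
  let φ := Int.castRingHom ℂ
  have hP := hp.map φ
  have hE := hp.expand two_pos
  have h0' : (p.map φ).coeff 0 ^ 2 = 1 := by
    rw [coeff_map]
    rcases h0 with h | h <;> simp [h, φ]
  have hinj : Function.Injective φ := Int.cast_injective
  apply hinj
  rcases hχ with rfl | rfl
  · have := discr_expand_two_sq hP h0'
    rw [← map_expand, hE.discr_map, hp.discr_map, hp.natDegree_map] at this
    simpa using this
  · have := discr_X_mul_expand_two_sq hP h0'
    rw [← map_expand, ← Polynomial.map_X φ, ← Polynomial.map_mul, (monic_X.mul hE).discr_map,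
      hp.discr_map, hp.natDegree_map] at this
    simpa using this

end Polynomial

/-! ### The characteristic polynomial of a bipartite block matrix. -/

namespace Matrix

lemma X_pow_mul_charpoly_fromBlocks {m n R : Type*} [Fintype m] [DecidableEq m] [Fintype n]
    [DecidableEq n] [CommRing R] (B : Matrix m n R) :
    X ^ Fintype.card m * (fromBlocks 0 B Bᵀ 0).charpoly =
      X ^ Fintype.card n * expand R 2 (B * Bᵀ).charpoly := by
  -- The right factor clears the lower left block and leaves `X² - BBᵀ` in the upper left one.
  have h1 : (fromBlocks 0 B Bᵀ 0).charmatrix *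
      fromBlocks ((X : R[X]) • 1) 0 (Bᵀ.map C) 1 =
      fromBlocks ((B * Bᵀ).charmatrix.map (expand R 2)) (-B.map C) 0 ((X : R[X]) • 1) := by
    rw [charmatrix_fromBlocks, charmatrix_zero, charmatrix_zero, scalar_apply, scalar_apply,
      ← smul_one_eq_diagonal, ← smul_one_eq_diagonal, fromBlocks_multiply]
    congr 1
    · ext1 i j
      by_cases hij : i = j
      · subst hij
        simp [mul_apply, sq, sub_eq_add_neg]
      · simp [mul_apply, hij]
    · simp
    · simp
    · simp
  have h2 := congrArg det h1
  have h3 : ((B * Bᵀ).charmatrix.map (expand R 2)).det = expand R 2 (B * Bᵀ).charpoly :=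
    (AlgHom.map_det (expand R 2) _).symm
  rw [det_mul, det_fromBlocks_zero₁₂, det_fromBlocks_zero₂₁, h3, det_one, mul_one, det_smul,
    det_smul, det_one, det_one, mul_one, mul_one] at h2
  rw [mul_comm, charpoly, h2, mul_comm]

end Matrix

/-! ### Signed graphs and their bipartitions. -/

namespace SignedGraph

lemma adjMatrix_of_adj {V : Type u} (S : SignedGraph V) {i j : V} (h : S.graph.Adj i j) :
    S.adjMatrix i j = (S.sign ⟨s(i, j), S.graph.mem_edgeSet.mpr h⟩ : ℤ) := by
  simp [adjMatrix, h]

lemma adjMatrix_of_not_adj {V : Type u} (S : SignedGraph V) {i j : V} (h : ¬ S.graph.Adj i j) :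
    S.adjMatrix i j = 0 := by
  simp [adjMatrix, h]

lemma adjMatrix_ne_zero_iff {V : Type u} (S : SignedGraph V) {i j : V} :
    S.adjMatrix i j ≠ 0 ↔ S.graph.Adj i j := by
  by_cases h : S.graph.Adj i j
  · simp [S.adjMatrix_of_adj h, h]
  · simp [S.adjMatrix_of_not_adj h, h]

lemma adjMatrix_isSymm {V : Type u} (S : SignedGraph V) : S.adjMatrix.IsSymm := by
  ext i j
  rw [Matrix.transpose_apply]
  by_cases h : S.graph.Adj i j
  · rw [S.adjMatrix_of_adj h, S.adjMatrix_of_adj h.symm]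
    congr 2
    exact Subtype.ext Sym2.eq_swap
  · rw [S.adjMatrix_of_not_adj h, S.adjMatrix_of_not_adj fun h' => h h'.symm]

lemma isIsomorphic_of_adjMatrix_eq {V : Type u} {W : Type v} {S : SignedGraph V}
    {T : SignedGraph W} (f : V ≃ W) (hf : ∀ i j, T.adjMatrix (f i) (f j) = S.adjMatrix i j) :
    S.IsIsomorphic T := by
  refine ⟨⟨f, fun {i j} => ?_⟩, ?_⟩
  · rw [← adjMatrix_ne_zero_iff, ← adjMatrix_ne_zero_iff, hf]
  · rintro ⟨e, he⟩
    induction e using Sym2.ind with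
    | _ i j =>
      have hS : S.graph.Adj i j := he
      have hT : T.graph.Adj (f i) (f j) := by
        rwa [← adjMatrix_ne_zero_iff, hf, adjMatrix_ne_zero_iff]
      have h := hf i j
      rw [S.adjMatrix_of_adj hS, T.adjMatrix_of_adj hT] at h
      exact Units.ext h

section Finite

variable {V : Type u} [Fintype V] [DecidableEq V] {S : SignedGraph V} {X : Finset V}

lemma block_mul_transpose_isSymm (S : SignedGraph V) (X : Finset V) :
    (S.block X * (S.block X).transpose).IsSymm := by
  rw [Matrix.IsSymm, Matrix.transpose_mul, Matrix.transpose_transpose]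

lemma X_pow_mul_charpoly (hX : S.graph.IsBipartiteWith (X : Set V) (X : Set V)ᶜ) :
    (Polynomial.X : ℤ[X]) ^ X.card * S.charpoly = Polynomial.X ^ (Fintype.card V - X.card) *
      expand ℤ 2 (S.block X * (S.block X).transpose).charpoly := by
  have h := Matrix.X_pow_mul_charpoly_fromBlocks (S.block X)
  have hA : Matrix.fromBlocks 0 (S.block X) (S.block X).transpose 0 =
      Matrix.reindex (Equiv.sumCompl (· ∈ X)).symm (Equiv.sumCompl (· ∈ X)).symm S.adjMatrix := by
    ext i j
    rcases i with i | i <;> rcases j with j | j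
    · refine (S.adjMatrix_of_not_adj fun hadj => ?_).symm
      rcases hX.mem_of_adj hadj with h | h
      · exact h.2 j.2
      · exact h.1 i.2
    · rfl
    · exact S.adjMatrix_isSymm.apply _ _
    · refine (S.adjMatrix_of_not_adj fun hadj => ?_).symm
      rcases hX.mem_of_adj hadj with h | h
      · exact i.2 h.1
      · exact j.2 h.2
  rw [hA, Matrix.charpoly_reindex, Fintype.card_coe, Fintype.card_subtype_compl,
    Fintype.card_coe] at h
  exact h

/-- The characteristic polynomial of a bipartite signed graph in terms of the block `B`. -/
lemma charpoly_eq_of_isBipartiteWith (hX : S.graph.IsBipartiteWith (X : Set V) (X : Set V)ᶜ)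
    (hcard : X.card ≤ Fintype.card V / 2)
    (heven : Even (Fintype.card V) → S.charpoly.coeff 0 = 1 ∨ S.charpoly.coeff 0 = -1)
    (hodd : Odd (Fintype.card V) → S.charpoly.coeff 1 = 1 ∨ S.charpoly.coeff 1 = -1) :
    ((S.block X * (S.block X).transpose).charpoly.coeff 0 = 1 ∨
      (S.block X * (S.block X).transpose).charpoly.coeff 0 = -1) ∧ X.card = Fintype.card V / 2 ∧
    (S.charpoly = expand ℤ 2 (S.block X * (S.block X).transpose).charpoly ∨
      S.charpoly = Polynomial.X * expand ℤ 2 (S.block X * (S.block X).transpose).charpoly) := by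
  have h := X_pow_mul_charpoly hX
  set p := (S.block X * (S.block X).transpose).charpoly
  -- Here `d = n - 2|X|` and `X ^ d` divides `χ`; the coefficient `±1` and the parity of `n` leave
  -- only `d = 0` or `d = 1`.
  obtain ⟨d, hd⟩ := Nat.exists_eq_add_of_le (show X.card ≤ Fintype.card V - X.card by omega)
  rw [hd, pow_add, mul_assoc] at h
  have hχ : S.charpoly = Polynomial.X ^ d * expand ℤ 2 p :=
    mul_left_cancel₀ (pow_ne_zero _ X_ne_zero) h
  have h0 : (expand ℤ 2 p).coeff 0 = p.coeff 0 := by simp [coeff_expand two_pos]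
  rcases Nat.even_or_odd (Fintype.card V) with hev | hod
  · have hc := heven hev
    have hd0 : d = 0 := by
      by_contra hne
      rw [hχ, mul_coeff_zero, coeff_X_pow, if_neg (Ne.symm hne), zero_mul] at hc
      simp at hc
    subst hd0
    rw [pow_zero, one_mul] at hχ
    rw [hχ, h0] at hc
    exact ⟨hc, by omega, Or.inl hχ⟩
  · have hc := hodd hod
    have hd1 : d = 1 := by
      have hdo : d ≠ 0 := by
        rintro rfl
        rw [Nat.odd_iff] at hod
        omega
      by_contra hne
      rw [hχ, coeff_X_pow_mul', if_neg (by omega)] at hc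
      simp at hc
    subst hd1
    rw [pow_one] at hχ
    rw [hχ, show (1 : ℕ) = 0 + 1 from rfl, coeff_X_mul, h0] at hc
    exact ⟨hc, by omega, Or.inr hχ⟩

lemma discr_eq_of_isBipartiteWith (hX : S.graph.IsBipartiteWith (X : Set V) (X : Set V)ᶜ)
    (hcard : X.card ≤ Fintype.card V / 2)
    (heven : Even (Fintype.card V) → S.charpoly.coeff 0 = 1 ∨ S.charpoly.coeff 0 = -1)
    (hodd : Odd (Fintype.card V) → S.charpoly.coeff 1 = 1 ∨ S.charpoly.coeff 1 = -1) :
    √(S.discr : ℝ) / 2 ^ (Fintype.card V / 2) =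
      ((S.block X * (S.block X).transpose).charpoly.discr : ℝ) := by
  obtain ⟨h0, hm, hχ⟩ := charpoly_eq_of_isBipartiteWith hX hcard heven hodd
  have hsq := discr_sq_of_eq_X_pow_mul_expand (Matrix.charpoly_monic _) h0 hχ
  rw [Matrix.charpoly_natDegree_eq_dim, Fintype.card_coe, hm] at hsq
  have hnn := Matrix.discr_charpoly_nonneg (S.block_mul_transpose_isSymm X)
  have hSnn : 0 ≤ S.discr := Matrix.discr_charpoly_nonneg S.adjMatrix_isSymm
  change S.discr ^ 2 = _ at hsq
  generalize (S.block X * (S.block X).transpose).charpoly.discr = d at *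
  -- Both sides are nonnegative, the discriminant of a symmetric matrix being so; this removes the
  -- sign ambiguity.
  have hS : S.discr = 4 ^ (Fintype.card V / 2) * d ^ 2 :=
    (sq_eq_sq₀ hSnn (by positivity)).mp hsq
  have hS' : (S.discr : ℝ) = (2 ^ (Fintype.card V / 2) * d) ^ 2 := by
    rw [hS, mul_pow, ← pow_mul, mul_comm _ 2, pow_mul]
    push_cast
    norm_num
  have hd : (0 : ℝ) ≤ d := by exact_mod_cast hnn
  rw [hS', Real.sqrt_sq (by positivity)]
  field_simp

/-- The two classes given need not cover isolated vertices, so one class is paired with its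
complement, and the smaller side is chosen. -/
lemma exists_isBipartiteWith_card_le (h : S.graph.IsBipartite) :
    ∃ X : Finset V, S.graph.IsBipartiteWith (X : Set V) (X : Set V)ᶜ ∧
      X.card ≤ Fintype.card V / 2 := by
  classical
  obtain ⟨s, t, hst⟩ := SimpleGraph.isBipartite_iff_exists_isBipartiteWith.mp h
  have hs : S.graph.IsBipartiteWith s sᶜ :=
    ⟨disjoint_compl_right, fun v w hvw => (hst.mem_of_adj hvw).imp
      (fun h => ⟨h.1, fun h' => Set.disjoint_left.mp hst.disjoint h' h.2⟩)
      (fun h => ⟨fun h' => Set.disjoint_left.mp hst.disjoint h' h.1, h.2⟩)⟩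
  by_cases hc : s.toFinset.card ≤ Fintype.card V / 2
  · exact ⟨s.toFinset, by simpa using hs, hc⟩
  · refine ⟨s.toFinsetᶜ, by simpa using hs.symm, ?_⟩
    rw [Finset.card_compl]
    omega

/-- A signed graph is determined by its generalized spectrum if its walk matrix has
corank at most one and squares detect divisibility by primes modulo its characteristic
polynomial. -/
theorem isDGS_of_sqDetects (hctrl : S.IsControllable ∨ S.IsAlmostControllable)
    (hχ : ∀ q : ℕ, q.Prime → S.charpoly.SqDetects q) : SignedGraph.IsDGS.{u, v} S := by
  intro W _ _ T hST
  obtain ⟨h1, h2⟩ := hST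
  have hcard : Fintype.card V = Fintype.card W := by
    have := congrArg natDegree h1
    rwa [charpoly, charpoly, Matrix.charpoly_natDegree_eq_dim,
      Matrix.charpoly_natDegree_eq_dim] at this
  let e : V ≃ W := Fintype.equivOfCardEq hcard
  let A' : Matrix V V ℤ := Matrix.reindex e.symm e.symm T.adjMatrix
  have hA' : A'.IsSymm := by
    ext i j
    exact T.adjMatrix_isSymm.apply _ _
  have hrank : Fintype.card V ≤ S.walkRank + 1 := by
    rcases hctrl with h | h
    · rw [IsControllable] at h
      omega
    · rw [IsAlmostControllable] at h
      omega
  have hcompl : ((Matrix.of fun _ _ => 1) - 1 - A' : Matrix V V ℤ) =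
      Matrix.reindex e.symm e.symm ((Matrix.of fun _ _ => 1) - 1 - T.adjMatrix) := by
    ext i j
    simp [A', Matrix.one_apply]
  obtain ⟨σ, hσ⟩ := Matrix.exists_perm_of_cospectral S.adjMatrix_isSymm hA'
    (h1.trans (Matrix.charpoly_reindex e.symm T.adjMatrix).symm)
    (by
      rw [hcompl, Matrix.charpoly_reindex]
      exact h2) hχ hrank
  refine isIsomorphic_of_adjMatrix_eq (σ.symm.trans e) fun i j => ?_
  have := hσ (σ.symm i) (σ.symm j)
  rw [Equiv.apply_symm_apply, Equiv.apply_symm_apply] at this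
  exact this.symm

end Finite

end SignedGraph

/-! ### The theorem. -/

theorem theorem2 {V : Type u} [Fintype V] [DecidableEq V] (S : SignedGraph V)
    (hbip : S.graph.IsBipartite)
    (hctrl : S.IsControllable ∨ S.IsAlmostControllable)
    (heven : Even (Fintype.card V) → S.charpoly.coeff 0 = 1 ∨ S.charpoly.coeff 0 = -1)
    (hodd : Odd (Fintype.card V) → S.charpoly.coeff 1 = 1 ∨ S.charpoly.coeff 1 = -1) :
    (∀ X : Finset V, S.graph.IsBipartiteWith (X : Set V) (X : Set V)ᶜ →
      X.card ≤ Fintype.card V / 2 →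
      √(S.discr : ℝ) / 2 ^ (Fintype.card V / 2) =
        ((S.block X * (S.block X).transpose).charpoly.discr : ℝ)) ∧
    (∀ k : ℤ, (k : ℝ) = √(S.discr : ℝ) / 2 ^ (Fintype.card V / 2) → Squarefree k →
      Odd k ∧ SignedGraph.IsDGS.{u, v} S) := by
  refine ⟨fun X hX hcard => SignedGraph.discr_eq_of_isBipartiteWith hX hcard heven hodd,
    fun k hk hsf => ?_⟩
  obtain ⟨X, hX, hcard⟩ := SignedGraph.exists_isBipartiteWith_card_le hbip
  rw [SignedGraph.discr_eq_of_isBipartiteWith hX hcard heven hodd, Int.cast_inj] at hk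
  subst hk
  have hM := S.block_mul_transpose_isSymm X
  have hprime : ∀ q : ℕ, q.Prime →
      ¬ (q : ℤ) ^ 2 ∣ (S.block X * (S.block X).transpose).charpoly.discr := fun q hq hdvd =>
    (Nat.prime_iff_prime_int.mp hq).not_isUnit (hsf q (sq (q : ℤ) ▸ hdvd))
  refine ⟨?_, SignedGraph.isDGS_of_sqDetects hctrl fun q hq => ?_⟩
  · rw [← Int.not_even_iff_odd, even_iff_two_dvd]
    exact fun h => hprime 2 Nat.prime_two (Matrix.four_dvd_discr_charpoly hM h)
  · obtain ⟨h0, -, hχ⟩ := SignedGraph.charpoly_eq_of_isBipartiteWith hX hcard heven hodd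
    have hE := sqDetects_expand hM h0 hq (hprime q hq)
    rcases hχ with hχ | hχ <;> rw [hχ]
    · exact hE
    · exact hE.X_mul hq (by simpa [coeff_expand two_pos] using h0)
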